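/- **Setting.** Let $x_O,x_D\in\mathbb R^2$, $\tilde L:=\|x_D-x_O\|$, $\bar v>0$, and let $w\in C^3(\mathbb R^2,\mathbb R^2)$ satisfy $\|w(x)\|<\bar v$ for all $x$ (Euclidean norm). For $p,q\in\mathbb R^2$ put $$f(p,q)=\frac{-q^Tw(p)+\sqrt{(q^Tw(p))^2+(\bar v^2-\|w(p)\|^2)\,\|q\|^2}}{\bar v^2-\|w(p)\|^2},\qquad T(\xi)=\int_0^1 f(\xi(\tau),\xi_\tau(\tau))\,d\tau .$$ Let $X=\{\xi\in W^{1,\infty}(]0,1[,\mathbb R^2):\xi(0)=x_O,\ \xi(1)=x_D\}$ (the Lipschitz paths from $x_O$ to $x_D$), $\delta X=W^{1,\infty}_0(]0,1[,\mathbb R^2)$, $Z=\mathbb R\times X\ni z=(L,\xi)$, $\delta Z=\mathbb R\times\delta X\ni\delta z=(\delta L,\delta\xi)$, $\Lambda=L^\infty(]0,1[,\mathbb R)$, and $Y=Z\times\Lambda^*\ni\chi=(z,\lambda)$. Put $$\|z\|_{Z^\infty}=|L|+\|\xi\|_{L^\infty}+\|\xi_\tau\|_{L^\infty},\qquad \|z\|_{Z^2}=|L|+\|\xi\|_{L^2}+\|\xi_\tau\|_{L^2},\qquad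 \|\chi\|_{Y^\infty}=\|z\|_{Z^\infty}+\|\lambda\|_{L^\infty},$$ where $\|\lambda\|_{L^\infty}$ is the $L^\infty$-norm of the function $m\in L^\infty(]0,1[)$ with $\langle\lambda,g\rangle=\int_0^1 m\,g\,d\tau$ for all $g\in\Lambda$, and $\infty$ if there is no such function. Let $h(z)=\xi_\tau^T\xi_\tau-L^2\in\Lambda$ and $\mathcal L(z,\lambda)=T(\xi)+\langle\lambda,h(z)\rangle$; derivatives of $T$ and $\mathcal L$ are directional, $T''(\xi)[\delta\xi]^2=\frac{d^2}{d\varepsilon^2}T(\xi+\varepsilon\,\delta\xi)|_{\varepsilon=0}$, and $\mathcal L_z(\chi)[\delta z]$, $\mathcal L_{zz}(\chi)[\delta z]^2$ are the first and second derivative of $\varepsilon\mapsto\mathcal L(z+\varepsilon\,\delta z,\lambda)$ at $\varepsilon=0$. Let $\Omega=\{p:\|p-x_O\|+\|p-x_D\|\le a\}$ with $a>\tilde L$ be an elliptical region with focal points $x_O,x_D$. For $\bar c_0,\dots,\bar c_3$ put $\underline v=(\bar v^2-\bar c_0^2)^{1/2}$, $$\bar\gamma_0=\tfrac{2}{\underline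 v^4}\left(37\bar c_1^3+21\bar c_1\bar c_2\underline v+2\bar c_3\underline v^2\right),\quad \bar\gamma_1=\tfrac1{\underline v^3}\left(29\bar c_1^2+7\underline v\bar c_2\right),\quad \bar\gamma_2=\tfrac1{\underline v^3}\left(57\bar c_1^2+13\underline v\bar c_2\right),$$ $$\bar\gamma_3=\tfrac{40\,\bar c_1}{\underline v^2},\quad \bar\gamma_4=\tfrac{20\,\bar c_1}{\underline v^2},\quad \bar\gamma_5=\tfrac{18}{\underline v},$$ $$\bar\Gamma(R)=\max\Big\{\Big(\tfrac{\bar v+\bar c_0}{\bar v-\bar c_0}\tilde L+R\Big)\bar\gamma_0+\tfrac{\bar\gamma_2}2,\ \ \tfrac{\bar\gamma_4}{\tilde L-R}+\tfrac{\bar\gamma_2}2,\ \ \bar\gamma_1+\tfrac{\bar\gamma_3}{2(\tilde L-R)},\ \ \tfrac{\bar\gamma_3}{2(\tilde L-R)}+\tfrac{\bar\gamma_5}{(\tilde L-R)^2}\Big\}.$$ **Theorem.** Assume $\|w\|\le\bar c_0<\bar v/\sqrt5$, $\|w_x\|\le\bar c_1$, $\|w_{xx}\|\le\bar c_2$ and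 $\|w_{xxx}\|\le\bar c_3$ on $\Omega$. Let $\chi^{**}=(z^{**},\lambda^{**})\in Y$, $z^{**}=(L^{**},\xi^{**})$, where $z^{**}$ is a global solution of $$\min_{\xi\in X,\ L\in\mathbb R}T(\xi)\quad\text{s.t.}\quad \|\xi_\tau\|^2=L^2\ \text{ almost everywhere in }]0,1[,$$ and suppose that $\chi^{**}$ satisfies 1. the necessary conditions $\mathcal L_z(\chi^{**})[\delta z]=0$ for all $\delta z\in\delta Z$ and $\langle\delta\lambda,h(z^{**})\rangle=0$ for all $\delta\lambda\in\Lambda^*$; 2. the inf-sup condition: there is $\kappa>0$ with $$\inf_{0\ne\delta\lambda\in L^2(]0,1[)}\ \sup_{0\ne\delta z\in\delta Z}\frac{\int_0^1\delta\lambda\,\big(2(\xi^{**}_\tau)^T\delta\xi_\tau-2L^{**}\delta L\big)\,d\tau}{\|\delta\lambda\|_{L^2}\,\|\delta z\|_{Z^2}}\ge\kappa;$$ 3. the second order sufficient condition with a constant $\underline{\mathcal B}>0$: $T''(\xi^{**})[\delta\xi]^2\ge\underline{\mathcal B}\,\|\delta z\|_{Z^2}^2$ for every $\delta z\in\delta Z$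 with $(\xi^{**}_\tau)^T\delta\xi_\tau=L^{**}\delta L$ almost everywhere. Then there is an $R$ with $$0<R<\min\Big\{\frac{\underline{\mathcal B}}{2\bar\Gamma(R)},\ \frac{\underline{\mathcal B}}{40},\ \frac{\tilde L}2\Big\}$$ such that for every $\chi=(z,\lambda)\in Y$, $z=(L,\xi)$, with $\|\chi-\chi^{**}\|_{Y^\infty}\le R$, and every $\delta z\in\delta Z$ with $\xi_\tau^T\delta\xi_\tau=L\,\delta L$ almost everywhere, the second derivative $\mathcal L_{zz}(\chi)[\delta z]^2$ exists and $$\mathcal L_{zz}(\chi)[\delta z]^2\ge\frac{\underline{\mathcal B}}4\,\|\delta z\|_{Z^2}^2 .$$ -/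

import Mathlib

open MeasureTheory Set Filter Topology
open scoped ENNReal

noncomputable section

namespace FreeFlight

/-- The plane `ℝ²` with the Euclidean norm. -/
abbrev Plane : Type := EuclideanSpace ℝ (Fin 2)

/-- Lebesgue measure on the open unit interval `]0,1[`. -/
def unitMeasure : Measure ℝ := volume.restrict (Ioo (0 : ℝ) 1)

/-! ### Spaces -/

/-- The affine space `X` of paths in `W^{1,∞}(]0,1[, ℝ²)` from `xO` to `xD`. On a bounded interval
`W^{1,∞}` consists of the Lipschitz functions, and the weak derivative of such a function is its
classical derivative, which exists almost everywhere; it is written `deriv ξ` throughout.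
Only the values on `[0,1]` matter. -/
def pathSpace (xO xD : Plane) : Set (ℝ → Plane) :=
  {ξ | (∃ K, LipschitzOnWith K ξ (Icc (0 : ℝ) 1)) ∧ ξ 0 = xO ∧ ξ 1 = xD}

/-- The space `δX = W^{1,∞}_0(]0,1[, ℝ²)`. -/
def dirX : Set (ℝ → Plane) := pathSpace 0 0

/-- Pairs `z = (L, ξ)`. -/
abbrev State : Type := ℝ × (ℝ → Plane)

/-- The set `Z = ℝ × X`. -/
def stateSpace (xO xD : Plane) : Set State := {z | z.2 ∈ pathSpace xO xD}

/-- The space `δZ = ℝ × δX`. -/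
def dirZ : Set State := {dz | dz.2 ∈ dirX}

/-- `Λ = L^∞(]0,1[, ℝ)`. -/
abbrev ConstraintSpace : Type := Lp ℝ ∞ unitMeasure

/-- The dual space `Λ*`. -/
abbrev Multiplier : Type := StrongDual ℝ ConstraintSpace

/-- Points `χ = (z, λ)`. -/
abbrev PrimalDual : Type := State × Multiplier

/-! ### Norms -/

/-- `‖z‖_{Z∞} = |L| + ‖ξ‖_{L^∞} + ‖ξ_τ‖_{L^∞}`. -/
def normZInf (z : State) : ℝ≥0∞ :=
  ‖z.1‖ₑ + eLpNorm z.2 ∞ unitMeasure + eLpNorm (deriv z.2) ∞ unitMeasure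

/-- `‖z‖_{Z2} = |L| + ‖ξ‖_{L²} + ‖ξ_τ‖_{L²}`. -/
def normZTwo (z : State) : ℝ :=
  |z.1| + (eLpNorm z.2 2 unitMeasure).toReal + (eLpNorm (deriv z.2) 2 unitMeasure).toReal

/-- `l ∈ Λ*` is the functional `g ↦ ∫ m g` of the function `m ∈ L^∞(]0,1[)`. -/
def Represents (m : ℝ → ℝ) (l : Multiplier) : Prop :=
  MemLp m ∞ unitMeasure ∧ ∀ g : ConstraintSpace, l g = ∫ τ, m τ * g τ ∂unitMeasure

/-- `‖λ‖_{L^∞}` for `λ ∈ Λ*`: the `L^∞` norm of the function that represents `λ`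
(unique up to null sets), and `∞` if there is none. -/
def multiplierNormInf (l : Multiplier) : ℝ≥0∞ :=
  ⨅ (m : ℝ → ℝ) (_ : Represents m l), eLpNorm m ∞ unitMeasure

/-- `‖χ‖_{Y∞} = ‖z‖_{Z∞} + ‖λ‖_{L^∞}`. -/
def normYInf (χ : PrimalDual) : ℝ≥0∞ := normZInf χ.1 + multiplierNormInf χ.2

/-- The closed `L^∞`-neighbourhood of radius `R` of `χ` in `Y = Z × Λ*`. -/
def nhdY (xO xD : Plane) (χ : PrimalDual) (R : ℝ) : Set PrimalDual :=
  {χ' | χ'.1 ∈ stateSpace xO xD ∧ normYInf (χ' - χ) ≤ ENNReal.ofReal R}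

/-! ### The optimization problem -/

/-- The integrand `f(p, q)`, for airspeed `v` and wind field `w`. -/
def integrand (v : ℝ) (w : Plane → Plane) (p q : Plane) : ℝ :=
  (-(inner ℝ q (w p)) + √((inner ℝ q (w p)) ^ 2 + (v ^ 2 - ‖w p‖ ^ 2) * ‖q‖ ^ 2))
    / (v ^ 2 - ‖w p‖ ^ 2)

/-- The flight duration `T(ξ) = ∫₀¹ f(ξ, ξ_τ) dτ`. -/
def travelTime (v : ℝ) (w : Plane → Plane) (ξ : ℝ → Plane) : ℝ :=
  ∫ τ, integrand v w (ξ τ) (deriv ξ τ) ∂unitMeasure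

/-- The constraint function `h(z) = ξ_τᵀ ξ_τ - L²`. -/
def constraint (z : State) (τ : ℝ) : ℝ := ‖deriv z.2 τ‖ ^ 2 - z.1 ^ 2

/-- The derivative `h'(z)[δz] = 2 ξ_τᵀ δξ_τ - 2 L δL`. -/
def constraintDeriv (z dz : State) (τ : ℝ) : ℝ :=
  2 * inner ℝ (deriv z.2 τ) (deriv dz.2 τ) - 2 * z.1 * dz.1

open Classical in
/-- The duality product `⟨λ, g⟩` of `λ ∈ Λ*` and an essentially bounded function `g`. -/
def pairing (l : Multiplier) (g : ℝ → ℝ) : ℝ :=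
  if hg : MemLp g ∞ unitMeasure then l (hg.toLp g) else 0

/-- The constraint function of an admissible state belongs to `L^∞(]0,1[)`, so that
`⟨λ, h(z)⟩` is always the value of `λ` at `h(z)`. -/
theorem memLp_constraint {xO xD : Plane} {z : State} (hz : z ∈ stateSpace xO xD) :
    MemLp (constraint z) ∞ unitMeasure := by
  obtain ⟨⟨K, hK⟩, -, -⟩ := hz
  have hm : Measurable (constraint z) :=
    (((measurable_deriv z.2).norm).pow_const 2).sub_const _
  refine memLp_top_of_bound hm.aestronglyMeasurable ((K : ℝ) ^ 2 + z.1 ^ 2) ?_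
  refine (ae_restrict_iff' measurableSet_Ioo).2 (Eventually.of_forall fun τ hτ => ?_)
  have hd : ‖deriv z.2 τ‖ ≤ K :=
    norm_deriv_le_of_lipschitzOn (Icc_mem_nhds hτ.1 hτ.2) hK
  have h2 : ‖deriv z.2 τ‖ ^ 2 ≤ (K : ℝ) ^ 2 := by gcongr
  have h0 : 0 ≤ ‖deriv z.2 τ‖ ^ 2 := by positivity
  have h1 : 0 ≤ z.1 ^ 2 := by positivity
  rw [Real.norm_eq_abs, abs_le]
  unfold constraint
  constructor <;> nlinarith

/-- `z` is a global solution of: minimize `T(ξ)` over `ξ ∈ X`, `L ∈ ℝ` subject to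
`‖ξ_τ‖² = L²` almost everywhere. -/
def IsGlobalSolution (v : ℝ) (w : Plane → Plane) (xO xD : Plane) (z : State) : Prop :=
  z ∈ stateSpace xO xD ∧ (∀ᵐ τ ∂unitMeasure, ‖deriv z.2 τ‖ ^ 2 = z.1 ^ 2) ∧
    ∀ z' ∈ stateSpace xO xD, (∀ᵐ τ ∂unitMeasure, ‖deriv z'.2 τ‖ ^ 2 = z'.1 ^ 2) →
      travelTime v w z.2 ≤ travelTime v w z'.2

/-- The Lagrangian `𝓛(z, λ) = T(ξ) + ⟨λ, h(z)⟩`. -/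
def lagrangian (v : ℝ) (w : Plane → Plane) (z : State) (l : Multiplier) : ℝ :=
  travelTime v w z.2 + pairing l (constraint z)

/-- The restriction `ε ↦ 𝓛(z + ε δz, λ)` of the Lagrangian to the line through `z` in
direction `δz`, where `χ = (z, λ)`. -/
def lagrangianLine (v : ℝ) (w : Plane → Plane) (χ : PrimalDual) (dz : State) (ε : ℝ) : ℝ :=
  lagrangian v w (χ.1 + ε • dz) χ.2

/-- `𝓛_z(χ)[δz]`. -/
def lagrangianZ (v : ℝ) (w : Plane → Plane) (χ : PrimalDual) (dz : State) : ℝ :=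
  deriv (lagrangianLine v w χ dz) 0

/-- `𝓛_zz(χ)[δz]²`. -/
def lagrangianZZ (v : ℝ) (w : Plane → Plane) (χ : PrimalDual) (dz : State) : ℝ :=
  iteratedDeriv 2 (lagrangianLine v w χ dz) 0

/-- `T''(ξ)[δξ]²`. -/
def travelTimeSecond (v : ℝ) (w : Plane → Plane) (ξ dξ : ℝ → Plane) : ℝ :=
  iteratedDeriv 2 (fun ε : ℝ => travelTime v w (ξ + ε • dξ)) 0

/-- `φ` has a second derivative at `a`: it is differentiable near `a`, and its derivative is
differentiable at `a`. -/
def TwiceDifferentiableAt (φ : ℝ → ℝ) (a : ℝ) : Prop :=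
  (∀ᶠ x in 𝓝 a, DifferentiableAt ℝ φ x) ∧ DifferentiableAt ℝ (deriv φ) a

/-! ### Optimality conditions -/

/-- The first order necessary (Karush–Kuhn–Tucker) conditions. -/
def NecessaryConditions (v : ℝ) (w : Plane → Plane) (χ : PrimalDual) : Prop :=
  (∀ dz ∈ dirZ, lagrangianZ v w χ dz = 0) ∧ ∀ dl : Multiplier, pairing dl (constraint χ.1) = 0

/-- The inf-sup condition at `z`: for some `κ > 0`, the infimum over `0 ≠ δλ ∈ L²(]0,1[)` of the
supremum over `0 ≠ δz ∈ δZ` of `⟨δλ, h'(z)[δz]⟩ / (‖δλ‖_{L²} ‖δz‖_{Z2})` is at least `κ`. -/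
def InfSupCondition (z : State) : Prop :=
  ∃ κ : ℝ, 0 < κ ∧
    (κ : EReal) ≤ ⨅ (m : ℝ → ℝ) (_ : MemLp m 2 unitMeasure) (_ : eLpNorm m 2 unitMeasure ≠ 0),
      ⨆ (dz : State) (_ : dz ∈ dirZ) (_ : normZTwo dz ≠ 0),
        (((∫ τ, m τ * constraintDeriv z dz τ ∂unitMeasure) /
          ((eLpNorm m 2 unitMeasure).toReal * normZTwo dz) : ℝ) : EReal)

/-- `δz` lies in the kernel of the linearized constraint at `z`:
`ξ_τᵀ δξ_τ = L δL` almost everywhere. -/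
def InConstraintKernel (z dz : State) : Prop :=
  ∀ᵐ τ ∂unitMeasure, inner ℝ (deriv z.2 τ) (deriv dz.2 τ) = z.1 * dz.1

/-- The second order sufficient condition at `z` with constant `B`:
`T''(ξ)[δξ]² ≥ B ‖δz‖_{Z2}²` on the kernel of the linearized constraint. -/
def SufficientCondition (v : ℝ) (w : Plane → Plane) (z : State) (B : ℝ) : Prop :=
  ∀ dz ∈ dirZ, InConstraintKernel z dz →
    B * normZTwo dz ^ 2 ≤ travelTimeSecond v w z.2 dz.2

/-! ### Domain and constants -/

/-- The region bounded by the ellipse with focal points `xO`, `xD` and major axis of length `a`. -/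
def ellipse (xO xD : Plane) (a : ℝ) : Set Plane := {p | dist p xO + dist p xD ≤ a}

/-- `v̲ = (v̄² - c₀²)^{1/2}`. -/
def vLow (v c0 : ℝ) : ℝ := √(v ^ 2 - c0 ^ 2)

def gamma0 (v c0 c1 c2 c3 : ℝ) : ℝ :=
  2 / vLow v c0 ^ 4 *
    (37 * c1 ^ 3 + 21 * c1 * c2 * vLow v c0 + 2 * c3 * vLow v c0 ^ 2)

def gamma1 (v c0 c1 c2 : ℝ) : ℝ :=
  1 / vLow v c0 ^ 3 * (29 * c1 ^ 2 + 7 * vLow v c0 * c2)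

def gamma2 (v c0 c1 c2 : ℝ) : ℝ :=
  1 / vLow v c0 ^ 3 * (57 * c1 ^ 2 + 13 * vLow v c0 * c2)

def gamma3 (v c0 c1 : ℝ) : ℝ := 40 * (c1 / vLow v c0 ^ 2)

def gamma4 (v c0 c1 : ℝ) : ℝ := 20 * (c1 / vLow v c0 ^ 2)

def gamma5 (v c0 : ℝ) : ℝ := 18 * (1 / vLow v c0)

/-- The constant `Γ̄`, where `Lt = ‖x_D - x_O‖`; it depends on the radius `R`. -/
def Gamma (v c0 c1 c2 c3 Lt R : ℝ) : ℝ :=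
  max
    (max (((v + c0) / (v - c0) * Lt + R) * gamma0 v c0 c1 c2 c3 + gamma2 v c0 c1 c2 / 2)
      (gamma4 v c0 c1 / (Lt - R) + gamma2 v c0 c1 c2 / 2))
    (max (gamma1 v c0 c1 c2 + gamma3 v c0 c1 / (2 * (Lt - R)))
      (gamma3 v c0 c1 / (2 * (Lt - R)) + gamma5 v c0 / (Lt - R) ^ 2))

end FreeFlight

end

/-!
Only the existence of some radius is claimed, so compactness and continuity replace the explicit
bounds, and what has to be shown is that the second order sufficient condition is stable under
small perturbations of state and multiplier in `L^∞`.

The key fact is that the multiplier of the global solution `(L, ξ)` is zero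
(`multiplier_eq_zero`). The constraint only fixes the parametrization: since the integrand is
positively homogeneous in the velocity, every Lipschitz path with speed bounded away from zero can
be reparametrized to constant speed at the same flight duration (`exists_constantSpeed`). Hence `ξ`
minimizes `T` locally along every line in `X` (`isLocalMin_travelTime_line`), so `T'(ξ) = 0`, and
the multiplier annihilates the range of the linearized constraint `h'(z)`. That range is all of
`L^∞`: `exists_linearized_constraint_eq` gives an explicit right inverse of `h'(z)`, bounded from
`L²` to the norm `‖·‖_{Z2}`. It exists as soon as the end points differ, which the inf-sup condition
guarantees (`endpoints_ne_of_infSup`).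

Near the solution the speed stays in a compact subset of `]0,∞[`, where the integrand is of class
`C³`. There `T''(ξ)[δξ]²` is the integral of the pointwise Hessian (`travelTime_line`), which is
bounded and uniformly continuous. For a direction `δz` in the kernel of the linearized constraint at
a nearby state, the right inverse yields a correction `c` with `‖c‖_{Z2} ≤ C R ‖δz‖_{Z2}` such that
`δz + c` lies in the kernel at the solution (`exists_kernel_correction`), where the sufficient
condition applies. Passing from `δz + c` to `δz`, changing the base point of the Hessian, and adding
the multiplier term `2 ⟨λ, ‖δξ_τ‖² - δL²⟩` with `‖λ‖_{L^∞}` of order `R` cost only a small multiple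
of `‖δz‖_{Z2}²` (`eventually_second_order_growth`).
-/

namespace FreeFlight

/-! ### Lipschitz paths on the unit interval -/

instance : IsProbabilityMeasure unitMeasure :=
  ⟨by simp [unitMeasure]⟩

theorem pathSpace_aestronglyMeasurable {xO xD : Plane} {ξ : ℝ → Plane} (h : ξ ∈ pathSpace xO xD) :
    AEStronglyMeasurable ξ unitMeasure := by
  obtain ⟨⟨K, hK⟩, -, -⟩ := h
  exact (hK.continuousOn.mono Ioo_subset_Icc_self).aestronglyMeasurable measurableSet_Ioo

theorem pathSpace_norm_deriv_le {xO xD : Plane} {ξ : ℝ → Plane} (h : ξ ∈ pathSpace xO xD) :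
    ∃ K : ℝ, 0 ≤ K ∧ ∀ τ ∈ Ioo (0 : ℝ) 1, ‖deriv ξ τ‖ ≤ K := by
  obtain ⟨⟨K, hK⟩, -, -⟩ := h
  exact ⟨K, K.2, fun τ hτ => norm_deriv_le_of_lipschitzOn (Icc_mem_nhds hτ.1 hτ.2) hK⟩

theorem pathSpace_norm_le {xO xD : Plane} {ξ : ℝ → Plane} (h : ξ ∈ pathSpace xO xD) :
    ∃ M : ℝ, 0 ≤ M ∧ ∀ τ ∈ Ioo (0 : ℝ) 1, ‖ξ τ‖ ≤ M := by
  obtain ⟨⟨K, hK⟩, h0, -⟩ := h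
  refine ⟨‖xO‖ + K, by positivity, fun τ hτ => ?_⟩
  have h1 := hK.dist_le_mul τ ⟨hτ.1.le, hτ.2.le⟩ 0 (by simp)
  rw [h0, dist_eq_norm, Real.dist_eq, sub_zero, abs_of_pos hτ.1] at h1
  have h2 : ‖ξ τ‖ ≤ ‖xO‖ + ‖ξ τ - xO‖ := by
    simpa using norm_add_le xO (ξ τ - xO)
  nlinarith [hτ.2, K.2]

theorem ae_unitMeasure_mem : ∀ᵐ τ ∂unitMeasure, τ ∈ Ioo (0 : ℝ) 1 :=
  ae_restrict_mem measurableSet_Ioo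

theorem pathSpace_ae_differentiableAt {xO xD : Plane} {ξ : ℝ → Plane} (h : ξ ∈ pathSpace xO xD) :
    ∀ᵐ τ ∂unitMeasure, DifferentiableAt ℝ ξ τ := by
  obtain ⟨⟨K, hK⟩, -, -⟩ := h
  have h1 := hK.ae_differentiableWithinAt_of_mem_real
  filter_upwards [ae_unitMeasure_mem, ae_restrict_of_ae h1] with τ hτ h2
  exact (h2 ⟨hτ.1.le, hτ.2.le⟩).differentiableAt (Icc_mem_nhds hτ.1 hτ.2)

theorem pathSpace_add_smul {xO xD : Plane} {ξ δ : ℝ → Plane} (h : ξ ∈ pathSpace xO xD)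
    (hδ : δ ∈ dirX) (ε : ℝ) : ξ + ε • δ ∈ pathSpace xO xD := by
  obtain ⟨⟨K, hK⟩, h0, h1⟩ := h
  obtain ⟨⟨K', hK'⟩, h0', h1'⟩ := hδ
  refine ⟨⟨K + ‖ε‖₊ * K', ?_⟩, by simp [h0, h0'], by simp [h1, h1']⟩
  exact hK.add ((lipschitzWith_smul ε).comp_lipschitzOnWith hK')

theorem ae_deriv_add_smul {xO xD yO yD : Plane} {ξ δ : ℝ → Plane} (h : ξ ∈ pathSpace xO xD)
    (hδ : δ ∈ pathSpace yO yD) :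
    ∀ᵐ τ ∂unitMeasure, ∀ ε : ℝ, deriv (ξ + ε • δ) τ = deriv ξ τ + ε • deriv δ τ := by
  filter_upwards [pathSpace_ae_differentiableAt h, pathSpace_ae_differentiableAt hδ]
    with τ h1 h2 ε
  rw [deriv_add h1 (h2.const_smul ε), deriv_const_smul _ h2]

theorem ae_deriv_sub {xO xD yO yD : Plane} {ξ δ : ℝ → Plane} (h : ξ ∈ pathSpace xO xD)
    (hδ : δ ∈ pathSpace yO yD) :
    ∀ᵐ τ ∂unitMeasure, deriv (ξ - δ) τ = deriv ξ τ - deriv δ τ := by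
  filter_upwards [pathSpace_ae_differentiableAt h, pathSpace_ae_differentiableAt hδ]
    with τ h1 h2
  rw [deriv_sub h1 h2]

theorem integrable_of_aebound {E : Type*} [NormedAddCommGroup E] {f : ℝ → E}
    (hm : AEStronglyMeasurable f unitMeasure) {C : ℝ} (h : ∀ᵐ τ ∂unitMeasure, ‖f τ‖ ≤ C) :
    Integrable f unitMeasure :=
  (memLp_top_of_bound hm C h).integrable le_top

theorem aestronglyMeasurable_deriv_plane (ξ : ℝ → Plane) :
    AEStronglyMeasurable (deriv ξ) unitMeasure :=
  (measurable_deriv ξ).aestronglyMeasurable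

theorem pathSpace_integrable_deriv {xO xD : Plane} {ξ : ℝ → Plane} (h : ξ ∈ pathSpace xO xD) :
    Integrable (deriv ξ) unitMeasure := by
  obtain ⟨K, -, hK⟩ := pathSpace_norm_deriv_le h
  exact integrable_of_aebound (aestronglyMeasurable_deriv_plane ξ) (C := K)
    (ae_unitMeasure_mem.mono hK)

/-- The fundamental theorem of calculus for Lipschitz paths. -/
theorem integral_deriv_pathSpace {xO xD : Plane} {ξ : ℝ → Plane} (h : ξ ∈ pathSpace xO xD) :
    ∫ τ, deriv ξ τ ∂unitMeasure = xD - xO := by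
  have hint := pathSpace_integrable_deriv h
  have hdiff := pathSpace_ae_differentiableAt h
  obtain ⟨⟨K, hK⟩, h0, h1⟩ := h
  ext i
  have hproj : LipschitzWith 1 (fun p : Plane => p i) :=
    LipschitzWith.of_dist_le_mul fun p q => by
      simpa [dist_eq_norm] using PiLp.norm_apply_le (p - q) i
  have hac : AbsolutelyContinuousOnInterval (fun τ => ξ τ i) 0 1 := by
    apply LipschitzOnWith.absolutelyContinuousOnInterval (K := 1 * K)
    rw [uIcc_of_le zero_le_one]
    exact hproj.comp_lipschitzOnWith hK
  have e1 := hac.integral_deriv_eq_sub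
  rw [h0, h1, intervalIntegral.integral_of_le zero_le_one, integral_Ioc_eq_integral_Ioo] at e1
  have e2 := (EuclideanSpace.proj (𝕜 := ℝ) i : Plane →L[ℝ] ℝ).integral_comp_comm hint
  simp only [EuclideanSpace.coe_proj] at e2
  rw [PiLp.sub_apply, ← e1, ← e2]
  refine integral_congr_ae ?_
  filter_upwards [hdiff] with τ hτ
  exact (((EuclideanSpace.proj (𝕜 := ℝ) i : Plane →L[ℝ] ℝ).hasFDerivAt.comp_hasDerivAt τ
    hτ.hasDerivAt).deriv).symm

/-- A bounded function with mean zero is the derivative of an element of `δX`. -/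
theorem exists_dirX_deriv_eq {u : ℝ → Plane} (hm : AEStronglyMeasurable u unitMeasure) {C : ℝ}
    (hC : ∀ᵐ τ ∂unitMeasure, ‖u τ‖ ≤ C) (h0 : ∫ τ, u τ ∂unitMeasure = 0) :
    ∃ δ ∈ dirX, (∀ᵐ τ ∂unitMeasure, deriv δ τ = u τ) ∧
      ∀ τ ∈ Ioo (0 : ℝ) 1, ‖δ τ‖ ≤ ∫ τ, ‖u τ‖ ∂unitMeasure := by
  have hi : Integrable u unitMeasure := integrable_of_aebound hm hC
  have hio : IntegrableOn u (Ioc 0 1) volume := by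
    rw [integrableOn_Ioc_iff_integrableOn_Ioo]; exact hi
  have hii : IntervalIntegrable u volume 0 1 :=
    (intervalIntegrable_iff_integrableOn_Ioc_of_le zero_le_one).2 hio
  have hC' : ∀ᵐ τ, τ ∈ Ioc (0 : ℝ) 1 → ‖u τ‖ ≤ C := by
    have h1 : ∀ᵐ τ ∂(volume.restrict (Ioc (0 : ℝ) 1)), ‖u τ‖ ≤ C := by
      rw [← restrict_Ioo_eq_restrict_Ioc]; exact hC
    exact (ae_restrict_iff' measurableSet_Ioc).1 h1
  refine ⟨fun t => ∫ τ in (0 : ℝ)..t, u τ, ⟨⟨(max C 0).toNNReal, ?_⟩, by simp, ?_⟩, ?_, ?_⟩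
  · refine LipschitzOnWith.of_dist_le_mul fun s hs t ht => ?_
    rw [dist_eq_norm, intervalIntegral.integral_interval_sub_left
      (hii.mono_set (by
        rw [uIcc_of_le hs.1, uIcc_of_le zero_le_one]
        exact Icc_subset_Icc_right hs.2))
      (hii.mono_set (by
        rw [uIcc_of_le ht.1, uIcc_of_le zero_le_one]
        exact Icc_subset_Icc_right ht.2)),
      Real.coe_toNNReal _ (le_max_right _ _), Real.dist_eq]
    refine intervalIntegral.norm_integral_le_of_norm_le_const_ae ?_
    filter_upwards [hC'] with τ h1 h2
    refine (h1 ?_).trans (le_max_left _ _)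
    rw [uIoc, mem_Ioc] at h2
    exact ⟨(le_min ht.1 hs.1).trans_lt h2.1, h2.2.trans (max_le ht.2 hs.2)⟩
  · show ∫ τ in (0 : ℝ)..1, u τ = 0
    rw [intervalIntegral.integral_of_le zero_le_one, integral_Ioc_eq_integral_Ioo]
    exact h0
  · filter_upwards [ae_unitMeasure_mem, ae_restrict_of_ae hii.ae_hasDerivAt_integral] with τ hτ h1
    rw [uIcc_of_le zero_le_one] at h1
    exact (h1 ⟨hτ.1.le, hτ.2.le⟩ 0 (by simp)).deriv
  · intro t ht
    refine (intervalIntegral.norm_integral_le_integral_norm ht.1.le).trans ?_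
    rw [intervalIntegral.integral_of_le ht.1.le]
    exact setIntegral_mono_set (f := fun τ => ‖u τ‖) hi.norm
      (Eventually.of_forall fun _ => norm_nonneg _)
      (LE.le.eventuallyLE (show Ioc 0 t ≤ Ioo (0 : ℝ) 1 from
        fun τ hτ => ⟨hτ.1, hτ.2.trans_lt ht.2⟩))

/-! ### The integrand -/

theorem integrand_denom_pos {v : ℝ} {w : Plane → Plane} (hwv : ∀ p, ‖w p‖ < v) (p : Plane) :
    0 < v ^ 2 - ‖w p‖ ^ 2 := by
  nlinarith [hwv p, norm_nonneg (w p)]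

theorem integrand_smul (v : ℝ) (w : Plane → Plane) (p q : Plane) {c : ℝ} (hc : 0 ≤ c) :
    integrand v w p (c • q) = c * integrand v w p q := by
  have h1 : (inner ℝ (c • q) (w p)) ^ 2 + (v ^ 2 - ‖w p‖ ^ 2) * ‖c • q‖ ^ 2
      = c ^ 2 * ((inner ℝ q (w p)) ^ 2 + (v ^ 2 - ‖w p‖ ^ 2) * ‖q‖ ^ 2) := by
    rw [real_inner_smul_left, norm_smul, Real.norm_of_nonneg hc]; ring
  unfold integrand
  rw [h1, Real.sqrt_mul (sq_nonneg c), Real.sqrt_sq hc, real_inner_smul_left]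
  ring

theorem integrand_nonneg {v : ℝ} {w : Plane → Plane} (hwv : ∀ p, ‖w p‖ < v) (p q : Plane) :
    0 ≤ integrand v w p q := by
  have hd := integrand_denom_pos hwv p
  refine div_nonneg ?_ hd.le
  have h1 : inner ℝ q (w p) ≤ √((inner ℝ q (w p)) ^ 2 + (v ^ 2 - ‖w p‖ ^ 2) * ‖q‖ ^ 2) :=
    (le_abs_self _).trans (Real.abs_le_sqrt (le_add_of_nonneg_right (by positivity)))
  linarith

theorem integrand_pos {v : ℝ} {w : Plane → Plane} (hwv : ∀ p, ‖w p‖ < v) (p : Plane) {q : Plane}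
    (hq : q ≠ 0) : 0 < integrand v w p q := by
  have hd := integrand_denom_pos hwv p
  refine div_pos ?_ hd
  have hq' : 0 < ‖q‖ := norm_pos_iff.2 hq
  have h1 : inner ℝ q (w p) < √((inner ℝ q (w p)) ^ 2 + (v ^ 2 - ‖w p‖ ^ 2) * ‖q‖ ^ 2) :=
    (le_abs_self _).trans_lt ((Real.lt_sqrt (abs_nonneg _)).2 (by
      rw [sq_abs]; exact lt_add_of_pos_right _ (by positivity)))
  linarith

theorem continuous_integrand {v : ℝ} {w : Plane → Plane} (hw : Continuous w)
    (hwv : ∀ p, ‖w p‖ < v) : Continuous fun x : Plane × Plane => integrand v w x.1 x.2 := by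
  unfold integrand
  exact Continuous.div (by fun_prop) (by fun_prop) fun x => (integrand_denom_pos hwv x.1).ne'

theorem contDiffAt_integrand {v : ℝ} {w : Plane → Plane} (hw : ContDiff ℝ 3 w)
    (hwv : ∀ p, ‖w p‖ < v) {x : Plane × Plane} (hx : x.2 ≠ 0) :
    ContDiffAt ℝ 3 (fun x : Plane × Plane => integrand v w x.1 x.2) x := by
  have hd := integrand_denom_pos hwv x.1
  have hq' : 0 < ‖x.2‖ := norm_pos_iff.2 hx
  have hw1 : ContDiffAt ℝ 3 (fun x : Plane × Plane => w x.1) x :=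
    (hw.comp contDiff_fst).contDiffAt
  have h2 : ContDiffAt ℝ 3 (fun x : Plane × Plane => x.2) x := contDiff_snd.contDiffAt
  have hi : ContDiffAt ℝ 3 (fun x : Plane × Plane => (inner ℝ x.2 (w x.1) : ℝ)) x :=
    h2.inner ℝ hw1
  have hn : ContDiffAt ℝ 3 (fun x : Plane × Plane => v ^ 2 - ‖w x.1‖ ^ 2) x :=
    contDiffAt_const.sub (hw1.norm_sq ℝ)
  have hs : ContDiffAt ℝ 3 (fun x : Plane × Plane =>
      (inner ℝ x.2 (w x.1) : ℝ) ^ 2 + (v ^ 2 - ‖w x.1‖ ^ 2) * ‖x.2‖ ^ 2) x :=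
    (hi.pow 2).add (hn.mul (h2.norm_sq ℝ))
  exact (hi.neg.add (hs.sqrt (by positivity))).div hn hd.ne'

/-! ### Reparametrization to constant speed -/

/-- A function of slope at least `c > 0` is onto as soon as it is continuous. -/
theorem surjective_of_slope_ge {g : ℝ → ℝ} (hg : Continuous g) {c : ℝ} (hc : 0 < c)
    (h : ∀ s t, s ≤ t → c * (t - s) ≤ g t - g s) : Function.Surjective g := by
  refine hg.surjective ?_ ?_
  · refine tendsto_atTop_mono' atTop (f₁ := fun t => g 0 + c * t) ?_ ?_
    · filter_upwards [eventually_ge_atTop 0] with t ht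
      have := h 0 t ht
      rw [sub_zero] at this
      linarith
    · exact tendsto_atTop_add_const_left _ _ (tendsto_id.const_mul_atTop hc)
  · refine tendsto_atBot_mono' atBot (f₁ := fun t => g 0 + c * t) ?_ ?_
    · filter_upwards [eventually_le_atBot 0] with t ht
      have := h t 0 ht
      rw [zero_sub] at this
      linarith
    · exact tendsto_atBot_add_const_left _ _ (tendsto_id.const_mul_atBot hc)

/-- A path whose speed is bounded away from `0` can be reparametrized to constant speed, and the
flight duration does not change: the integrand is positively homogeneous in the velocity. -/
theorem exists_constantSpeed (v : ℝ) (w : Plane → Plane) {xO xD : Plane} {η : ℝ → Plane}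
    (h : η ∈ pathSpace xO xD) {r : ℝ} (hr : 0 < r) (hη : ∀ᵐ τ ∂unitMeasure, r ≤ ‖deriv η τ‖) :
    ∃ ζ ∈ pathSpace xO xD, ∃ l : ℝ, (∀ᵐ τ ∂unitMeasure, ‖deriv ζ τ‖ = l) ∧
      travelTime v w ζ = travelTime v w η := by
  obtain ⟨K, hK0, hK⟩ := pathSpace_norm_deriv_le h
  have hdiff := pathSpace_ae_differentiableAt h
  obtain ⟨⟨K', hK'⟩, h0, h1⟩ := h
  -- The speed, clamped to a compact subset of `]0,∞[` so that it is harmless outside `]0,1[`.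
  set n : ℝ → ℝ := fun τ => max r (min K ‖deriv η τ‖) with hn
  have hnm : Measurable n := by
    exact measurable_const.max (measurable_const.min (measurable_deriv η).norm)
  have hnr : ∀ τ, r ≤ n τ := fun τ => le_max_left _ _
  have hnK : ∀ τ, n τ ≤ max r K := fun τ => max_le_max le_rfl (min_le_left _ _)
  have hnloc : LocallyIntegrable n volume := by
    refine (locallyIntegrable_const (max r K)).mono hnm.aestronglyMeasurable ?_
    refine Eventually.of_forall fun τ => ?_
    rw [Real.norm_of_nonneg (hr.le.trans (hnr τ)),
      Real.norm_of_nonneg (hr.le.trans (le_max_left _ _))]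
    exact hnK τ
  have hnii : ∀ s t, IntervalIntegrable n volume s t := fun s t =>
    (hnloc.integrableOn_isCompact isCompact_uIcc).intervalIntegrable
  set S : ℝ → ℝ := fun t => ∫ τ in (0 : ℝ)..t, n τ with hS
  have hSsub : ∀ s t, S t - S s = ∫ τ in s..t, n τ := fun s t =>
    intervalIntegral.integral_interval_sub_left (hnii _ _) (hnii _ _)
  have hSlow : ∀ s t, s ≤ t → r * (t - s) ≤ S t - S s := fun s t hst => by
    rw [hSsub]
    have := intervalIntegral.integral_mono_on hst (intervalIntegrable_const (c := r)) (hnii s t)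
      fun x _ => hnr x
    rw [intervalIntegral.integral_const, smul_eq_mul] at this
    linarith
  have hSlip : LipschitzWith (max r K).toNNReal S := by
    refine LipschitzWith.of_dist_le_mul fun s t => ?_
    rw [dist_eq_norm, hSsub, Real.coe_toNNReal _ (hr.le.trans (le_max_left _ _)), Real.dist_eq]
    refine intervalIntegral.norm_integral_le_of_norm_le_const fun τ _ => ?_
    rw [Real.norm_of_nonneg (hr.le.trans (hnr τ))]
    exact hnK τ
  have hS0 : S 0 = 0 := by simp [hS]
  set l := S 1 with hl
  have hrl : r ≤ l := by
    have := hSlow 0 1 zero_le_one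
    rw [hS0] at this
    linarith
  have hl0 : 0 < l := hr.trans_le hrl
  -- Normalized arc length and its inverse.
  set σ : ℝ → ℝ := fun t => l⁻¹ * S t with hσ
  have hσlow : ∀ s t, s ≤ t → l⁻¹ * r * (t - s) ≤ σ t - σ s := fun s t hst => by
    have := mul_le_mul_of_nonneg_left (hSlow s t hst) (inv_nonneg.2 hl0.le)
    simp only [hσ]
    linarith
  have hc : 0 < l⁻¹ * r := by positivity
  have hσmono : StrictMono σ := fun s t hst => by
    have := hσlow s t hst.le
    have : 0 < l⁻¹ * r * (t - s) := mul_pos hc (sub_pos.2 hst)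
    linarith
  have hσlip : LipschitzWith (‖l⁻¹‖₊ * (max r K).toNNReal) σ :=
    (lipschitzWith_smul l⁻¹).comp hSlip
  have hσsurj := surjective_of_slope_ge hσlip.continuous hc hσlow
  have hσ0 : σ 0 = 0 := by simp [hσ, hS0]
  have hσ1 : σ 1 = 1 := by simp only [hσ, ← hl]; exact inv_mul_cancel₀ hl0.ne'
  set O := hσmono.orderIsoOfSurjective σ hσsurj with hO
  set ρ : ℝ → ℝ := fun s => O.symm s with hρ
  have hσρ : ∀ s, σ (ρ s) = s := fun s => O.apply_symm_apply s
  have hρσ : ∀ t, ρ (σ t) = t := fun t => O.symm_apply_apply t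
  have hρmono : StrictMono ρ := O.symm.strictMono
  have hρ0 : ρ 0 = 0 := by simpa [hσ0] using hρσ 0
  have hρ1 : ρ 1 = 1 := by simpa [hσ1] using hρσ 1
  have hρlip : LipschitzWith (l⁻¹ * r)⁻¹.toNNReal ρ := by
    refine LipschitzWith.of_dist_le_mul fun s t => ?_
    wlog hst : t ≤ s generalizing s t
    · rw [dist_comm, dist_comm s]; exact this t s (le_of_not_ge hst)
    have h2 := hσlow (ρ t) (ρ s) (hρmono.monotone hst)
    rw [hσρ, hσρ] at h2
    rw [Real.coe_toNNReal _ (inv_nonneg.2 hc.le), Real.dist_eq, Real.dist_eq,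
      abs_of_nonneg (sub_nonneg.2 (hρmono.monotone hst)), abs_of_nonneg (sub_nonneg.2 hst),
      inv_mul_eq_div, le_div_iff₀ hc]
    linarith
  have hρmaps : MapsTo ρ (Icc 0 1) (Icc 0 1) := fun s hs =>
    ⟨by rw [← hρ0]; exact hρmono.monotone hs.1, by rw [← hρ1]; exact hρmono.monotone hs.2⟩
  -- The set where everything is differentiable.
  have hgood : ∀ᵐ τ, τ ∈ Ioo (0 : ℝ) 1 →
      DifferentiableAt ℝ η τ ∧ HasDerivAt S (n τ) τ ∧ n τ = ‖deriv η τ‖ := by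
    have a1 := (ae_restrict_iff' measurableSet_Ioo).1 hdiff
    have a2 := (ae_restrict_iff' measurableSet_Ioo).1 hη
    filter_upwards [a1, a2, _root_.LocallyIntegrable.ae_hasDerivAt_integral hnloc]
      with τ b1 b2 b3 hτ
    refine ⟨b1 hτ, b3 0, ?_⟩
    rw [hn]
    simp only
    rw [min_eq_right (hK τ hτ), max_eq_right (b2 hτ)]
  set N : Set ℝ := toMeasurable volume {τ | ¬ (τ ∈ Ioo (0 : ℝ) 1 →
      DifferentiableAt ℝ η τ ∧ HasDerivAt S (n τ) τ ∧ n τ = ‖deriv η τ‖)} with hN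
  have hN0 : volume N = 0 := by rw [hN, measure_toMeasurable]; exact hgood
  set G : Set ℝ := Ioo 0 1 \ N with hG
  have hGm : MeasurableSet G := measurableSet_Ioo.diff (measurableSet_toMeasurable _ _)
  have hGgood : ∀ τ ∈ G, DifferentiableAt ℝ η τ ∧ HasDerivAt S (n τ) τ ∧ n τ = ‖deriv η τ‖ := by
    intro τ hτ
    by_contra hcon
    exact hτ.2 (subset_toMeasurable _ _ fun h => hcon (h hτ.1))
  have hσN : volume (σ '' N) = 0 := by
    have := hσlip.hausdorffMeasure_image_le zero_le_one N
    rw [hausdorffMeasure_real, hN0, mul_zero] at this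
    exact le_antisymm this bot_le
  have hσIoo : σ '' Ioo 0 1 = Ioo 0 1 := by
    ext s
    constructor
    · rintro ⟨t, ht, rfl⟩
      exact ⟨by rw [← hσ0]; exact hσmono ht.1, by rw [← hσ1]; exact hσmono ht.2⟩
    · intro hs
      exact ⟨ρ s, ⟨by rw [← hρ0]; exact hρmono hs.1, by rw [← hρ1]; exact hρmono hs.2⟩, hσρ s⟩
  have hGae : (G : Set ℝ) =ᵐ[volume] Ioo (0 : ℝ) 1 :=
    sdiff_null_ae_eq_self hN0
  have hσGae : (σ '' G : Set ℝ) =ᵐ[volume] Ioo (0 : ℝ) 1 := by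
    rw [hG, image_sdiff hσmono.injective, hσIoo]
    exact sdiff_null_ae_eq_self hσN
  have hσderiv : ∀ τ ∈ G, HasDerivAt σ (l⁻¹ * n τ) τ := fun τ hτ =>
    (hGgood τ hτ).2.1.const_mul l⁻¹
  have hζderiv : ∀ τ ∈ G, deriv (η ∘ ρ) (σ τ) = (l⁻¹ * n τ)⁻¹ • deriv η τ := by
    intro τ hτ
    have hne : l⁻¹ * n τ ≠ 0 := (mul_pos (inv_pos.2 hl0) (hr.trans_le (hnr τ))).ne'
    have hρd : HasDerivAt ρ (l⁻¹ * n τ)⁻¹ (σ τ) :=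
      HasDerivAt.of_local_left_inverse hρlip.continuous.continuousAt
        (by rw [hρσ]; exact hσderiv τ hτ) hne (Eventually.of_forall hσρ)
    have hηd : HasDerivAt η (deriv η τ) (ρ (σ τ)) := by
      rw [hρσ]; exact (hGgood τ hτ).1.hasDerivAt
    exact (hηd.scomp (σ τ) hρd).deriv
  refine ⟨η ∘ ρ, ⟨⟨K' * (l⁻¹ * r)⁻¹.toNNReal, hK'.comp hρlip.lipschitzOnWith hρmaps⟩,
    by simp [hρ0, h0], by simp [hρ1, h1]⟩, l, ?_, ?_⟩
  · have : ∀ᵐ s ∂unitMeasure, s ∈ σ '' G := by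
      rw [unitMeasure, ← Measure.restrict_congr_set hσGae]
      refine ae_restrict_mem ?_
      have e : σ '' G = ρ ⁻¹' G := by
        ext s
        exact ⟨by rintro ⟨t, ht, rfl⟩; simpa [hρσ] using ht, fun hs => ⟨ρ s, hs, hσρ s⟩⟩
      rw [e]
      exact hρlip.continuous.measurable hGm
    filter_upwards [this] with s hs
    obtain ⟨τ, hτ, rfl⟩ := hs
    have hpos : 0 < n τ := hr.trans_le (hnr τ)
    rw [hζderiv τ hτ, norm_smul, ← (hGgood τ hτ).2.2, Real.norm_of_nonneg (by positivity)]
    field_simp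
  · have e1 : travelTime v w (η ∘ ρ)
        = ∫ s in σ '' G, integrand v w ((η ∘ ρ) s) (deriv (η ∘ ρ) s) := by
      rw [travelTime, unitMeasure, ← Measure.restrict_congr_set hσGae]
    have e2 : travelTime v w η = ∫ τ in G, integrand v w (η τ) (deriv η τ) := by
      rw [travelTime, unitMeasure, ← Measure.restrict_congr_set hGae]
    rw [e1, e2, integral_image_eq_integral_abs_deriv_smul hGm
      (fun τ hτ => (hσderiv τ hτ).hasDerivWithinAt) hσmono.injective.injOn]
    refine setIntegral_congr_fun hGm fun τ hτ => ?_
    have hpos : 0 < l⁻¹ * n τ := mul_pos (inv_pos.2 hl0) (hr.trans_le (hnr τ))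
    simp only [Function.comp_apply]
    rw [hζderiv τ hτ, hρσ, integrand_smul _ _ _ _ (inv_nonneg.2 hpos.le), abs_of_pos hpos,
      smul_eq_mul, mul_inv_cancel_left₀ hpos.ne']

/-- Along a line through a global solution of nonzero speed, the flight duration has a local
minimum: nearby paths, which need not satisfy the constraint, can be reparametrized. -/
theorem isLocalMin_travelTime_line {v : ℝ} {w : Plane → Plane} {xO xD : Plane} {z : State}
    (hz : IsGlobalSolution v w xO xD z) (hL : z.1 ≠ 0) {δ : ℝ → Plane} (hδ : δ ∈ dirX) :
    IsLocalMin (fun ε : ℝ => travelTime v w (z.2 + ε • δ)) 0 := by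
  obtain ⟨hzX, hc, hmin⟩ := hz
  obtain ⟨K, hK0, hK⟩ := pathSpace_norm_deriv_le hδ
  have hL' : 0 < |z.1| := abs_pos.2 hL
  have hev : ∀ᶠ ε : ℝ in 𝓝 0, |ε| * K < |z.1| / 2 := by
    have : Tendsto (fun ε : ℝ => |ε| * K) (𝓝 0) (𝓝 (|0| * K)) := by
      exact (continuous_abs.mul continuous_const).tendsto 0
    rw [abs_zero, zero_mul] at this
    exact this.eventually_lt_const (by positivity)
  filter_upwards [hev] with ε hε
  have hη := pathSpace_add_smul hzX hδ ε
  obtain ⟨ζ, hζ, l, hl, hT⟩ := exists_constantSpeed v w hη (half_pos hL') (by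
    filter_upwards [hc, ae_deriv_add_smul hzX hδ, ae_unitMeasure_mem] with τ h1 h2 h3
    rw [h2 ε]
    have h4 : ‖deriv z.2 τ‖ = |z.1| := by
      rw [← abs_of_nonneg (norm_nonneg (deriv z.2 τ)), ← sq_eq_sq_iff_abs_eq_abs]; exact h1
    have h5 : ‖deriv z.2 τ‖ - ‖ε • deriv δ τ‖ ≤ ‖deriv z.2 τ + ε • deriv δ τ‖ :=
      norm_sub_le_norm_add _ _
    rw [norm_smul, Real.norm_eq_abs] at h5
    have h6 := mul_le_mul_of_nonneg_left (hK τ h3) (abs_nonneg ε)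
    linarith)
  have := hmin (l, ζ) hζ (by filter_upwards [hl] with τ h; rw [h])
  simp only [zero_smul, add_zero]
  rw [← hT]
  exact this

/-! ### Differentiation under the integral sign -/

theorem hasDerivAt_integral_of_bounded {φ φ' : ℝ → ℝ → ℝ} {C C' ε₀ : ℝ}
    (hm : ∀ ε, AEStronglyMeasurable (φ ε) unitMeasure)
    (hm' : ∀ ε, AEStronglyMeasurable (φ' ε) unitMeasure)
    (hC : ∀ᵐ τ ∂unitMeasure, ∀ ε ∈ Ioo (-ε₀) ε₀, |φ ε τ| ≤ C)
    (hC' : ∀ᵐ τ ∂unitMeasure, ∀ ε ∈ Ioo (-ε₀) ε₀, |φ' ε τ| ≤ C')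
    (hd : ∀ᵐ τ ∂unitMeasure, ∀ ε ∈ Ioo (-ε₀) ε₀, HasDerivAt (φ · τ) (φ' ε τ) ε)
    {ε : ℝ} (hε : ε ∈ Ioo (-ε₀) ε₀) :
    HasDerivAt (fun ε => ∫ τ, φ ε τ ∂unitMeasure) (∫ τ, φ' ε τ ∂unitMeasure) ε :=
  (hasDerivAt_integral_of_dominated_loc_of_deriv_le (bound := fun _ => C')
    (isOpen_Ioo.mem_nhds hε) (Eventually.of_forall hm)
    (integrable_of_aebound (hm ε) (C := C) (hC.mono fun _ h => h ε hε)) (hm' ε) hC'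
    (integrable_const _) hd).2

theorem aestronglyMeasurable_clm_apply {E F : Type*} [NormedAddCommGroup E]
    [NormedSpace ℝ E] [NormedAddCommGroup F] [NormedSpace ℝ F]
    {A : ℝ → E →L[ℝ] F} {x : ℝ → E} (hA : AEStronglyMeasurable A unitMeasure)
    (hx : AEStronglyMeasurable x unitMeasure) :
    AEStronglyMeasurable (fun τ => A τ (x τ)) unitMeasure :=
  (isBoundedBilinearMap_apply (𝕜 := ℝ) (E := E) (F := F)).continuous.comp_aestronglyMeasurable
    (hA.prodMk hx)

section Line

variable {E : Type*} [NormedAddCommGroup E] [NormedSpace ℝ E] [FiniteDimensional ℝ E]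
  [MeasurableSpace E] [BorelSpace E]

theorem aestronglyMeasurable_fderiv_comp {F : Type*} [NormedAddCommGroup F] [NormedSpace ℝ F]
    [FiniteDimensional ℝ F] (g : E → F) {x : ℝ → E} (hx : AEStronglyMeasurable x unitMeasure) :
    AEStronglyMeasurable (fun τ => fderiv ℝ g (x τ)) unitMeasure := by
  have : CompleteSpace F := FiniteDimensional.complete ℝ F
  exact ((measurable_fderiv ℝ g).comp_aemeasurable hx.aemeasurable).aestronglyMeasurable

theorem aestronglyMeasurable_second_fderiv (g : E → ℝ) {x b : ℝ → E}
    (hx : AEStronglyMeasurable x unitMeasure) (hb : AEStronglyMeasurable b unitMeasure) :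
    AEStronglyMeasurable (fun τ => fderiv ℝ (fderiv ℝ g) (x τ) (b τ) (b τ)) unitMeasure :=
  aestronglyMeasurable_clm_apply
    (aestronglyMeasurable_clm_apply (aestronglyMeasurable_fderiv_comp (fderiv ℝ g) hx) hb) hb

/-- Second derivative of `ε ↦ ∫ g (a + ε b)`, when the curves `a + ε b` stay in a compact set near
which `g` is of class `C²`. -/
theorem second_deriv_integral_line {g : E → ℝ} (hg : Measurable g) {K : Set E} (hK : IsCompact K)
    (hgK : ∀ x ∈ K, ContDiffAt ℝ 2 g x) {a b : ℝ → E} (ha : AEStronglyMeasurable a unitMeasure)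
    (hb : AEStronglyMeasurable b unitMeasure) {M ε₀ : ℝ} (hM : ∀ᵐ τ ∂unitMeasure, ‖b τ‖ ≤ M)
    (hε₀ : 0 < ε₀)
    (hline : ∀ᵐ τ ∂unitMeasure, ∀ ε ∈ Ioo (-ε₀) ε₀, a τ + ε • b τ ∈ K) :
    TwiceDifferentiableAt (fun ε : ℝ => ∫ τ, g (a τ + ε • b τ) ∂unitMeasure) 0 ∧
      iteratedDeriv 2 (fun ε : ℝ => ∫ τ, g (a τ + ε • b τ) ∂unitMeasure) 0 =
        ∫ τ, fderiv ℝ (fderiv ℝ g) (a τ) (b τ) (b τ) ∂unitMeasure := by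
  have hg1 : ∀ x ∈ K, ContDiffAt ℝ 1 (fderiv ℝ g) x := fun x hx =>
    (hgK x hx).fderiv_right (by norm_num)
  have hg2 : ∀ x ∈ K, ContDiffAt ℝ 0 (fderiv ℝ (fderiv ℝ g)) x := fun x hx =>
    (hg1 x hx).fderiv_right (by norm_num)
  obtain ⟨C0, hC0⟩ := hK.exists_bound_of_continuousOn
    fun x hx => (hgK x hx).continuousAt.continuousWithinAt
  obtain ⟨C1, hC1⟩ := hK.exists_bound_of_continuousOn
    fun x hx => (hg1 x hx).continuousAt.continuousWithinAt
  obtain ⟨C2, hC2⟩ := hK.exists_bound_of_continuousOn (f := fderiv ℝ (fderiv ℝ g))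
    fun x hx => (hg2 x hx).continuousAt.continuousWithinAt
  have hmem0 : (0 : ℝ) ∈ Ioo (-ε₀) ε₀ := ⟨by linarith, hε₀⟩
  have hmx : ∀ ε : ℝ, AEStronglyMeasurable (fun τ => a τ + ε • b τ) unitMeasure := fun ε =>
    ha.add (hb.const_smul ε)
  have hm0 : ∀ ε : ℝ, AEStronglyMeasurable (fun τ => g (a τ + ε • b τ)) unitMeasure := fun ε =>
    (hg.comp_aemeasurable (hmx ε).aemeasurable).aestronglyMeasurable
  have hm1 : ∀ ε : ℝ, AEStronglyMeasurable (fun τ => fderiv ℝ g (a τ + ε • b τ) (b τ))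
      unitMeasure := fun ε =>
    aestronglyMeasurable_clm_apply (aestronglyMeasurable_fderiv_comp g (hmx ε)) hb
  have hm2 : ∀ ε : ℝ, AEStronglyMeasurable
      (fun τ => fderiv ℝ (fderiv ℝ g) (a τ + ε • b τ) (b τ) (b τ)) unitMeasure := fun ε =>
    aestronglyMeasurable_second_fderiv g (hmx ε) hb
  have hxd : ∀ τ ε : ℝ, HasDerivAt (fun ε : ℝ => a τ + ε • b τ) (b τ) ε := fun τ ε => by
    simpa using ((hasDerivAt_id ε).smul_const (b τ)).const_add (a τ)
  have hb0 : ∀ᵐ τ ∂unitMeasure, ∀ ε ∈ Ioo (-ε₀) ε₀, |g (a τ + ε • b τ)| ≤ C0 := by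
    filter_upwards [hline] with τ h ε hε
    exact hC0 _ (h ε hε)
  have hb1 : ∀ᵐ τ ∂unitMeasure, ∀ ε ∈ Ioo (-ε₀) ε₀,
      |fderiv ℝ g (a τ + ε • b τ) (b τ)| ≤ C1 * M := by
    filter_upwards [hline, hM] with τ h hMτ ε hε
    exact (ContinuousLinearMap.le_opNorm _ _).trans (mul_le_mul (hC1 _ (h ε hε)) hMτ
      (norm_nonneg _) ((norm_nonneg _).trans (hC1 _ (h ε hε))))
  have hb2 : ∀ᵐ τ ∂unitMeasure, ∀ ε ∈ Ioo (-ε₀) ε₀,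
      |fderiv ℝ (fderiv ℝ g) (a τ + ε • b τ) (b τ) (b τ)| ≤ C2 * M * M := by
    filter_upwards [hline, hM] with τ h hMτ ε hε
    have hc := hC2 _ (h ε hε)
    have hM0 := (norm_nonneg _).trans hMτ
    have hc0 := (norm_nonneg _).trans hc
    refine (ContinuousLinearMap.le_opNorm₂ (fderiv ℝ (fderiv ℝ g) (a τ + ε • b τ)) _ _).trans ?_
    gcongr
  have hd1 : ∀ᵐ τ ∂unitMeasure, ∀ ε ∈ Ioo (-ε₀) ε₀,
      HasDerivAt (fun ε => g (a τ + ε • b τ)) (fderiv ℝ g (a τ + ε • b τ) (b τ)) ε := by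
    filter_upwards [hline] with τ h ε hε
    exact ((hgK _ (h ε hε)).differentiableAt (by norm_num)).hasFDerivAt.comp_hasDerivAt ε (hxd τ ε)
  have hd2 : ∀ᵐ τ ∂unitMeasure, ∀ ε ∈ Ioo (-ε₀) ε₀,
      HasDerivAt (fun ε => fderiv ℝ g (a τ + ε • b τ) (b τ))
        (fderiv ℝ (fderiv ℝ g) (a τ + ε • b τ) (b τ) (b τ)) ε := by
    filter_upwards [hline] with τ h ε hε
    have h1 : HasDerivAt (fun ε : ℝ => fderiv ℝ g (a τ + ε • b τ))
        (fderiv ℝ (fderiv ℝ g) (a τ + ε • b τ) (b τ)) ε :=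
      ((hg1 _ (h ε hε)).differentiableAt (by norm_num)).hasFDerivAt.comp_hasDerivAt ε (hxd τ ε)
    simpa using h1.clm_apply (hasDerivAt_const ε (b τ))
  have D1 := fun ε hε => hasDerivAt_integral_of_bounded hm0 hm1 hb0 hb1 hd1 (ε := ε) hε
  have D2 := fun ε hε => hasDerivAt_integral_of_bounded hm1 hm2 hb1 hb2 hd2 (ε := ε) hε
  have hderiv : deriv (fun ε : ℝ => ∫ τ, g (a τ + ε • b τ) ∂unitMeasure) =ᶠ[𝓝 0]
      fun ε => ∫ τ, fderiv ℝ g (a τ + ε • b τ) (b τ) ∂unitMeasure := by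
    filter_upwards [isOpen_Ioo.mem_nhds hmem0] with ε hε
    exact (D1 ε hε).deriv
  refine ⟨⟨?_, ?_⟩, ?_⟩
  · filter_upwards [isOpen_Ioo.mem_nhds hmem0] with ε hε
    exact (D1 ε hε).differentiableAt
  · exact (D2 0 hmem0).differentiableAt.congr_of_eventuallyEq hderiv
  · rw [iteratedDeriv_succ, iteratedDeriv_one, hderiv.deriv_eq, (D2 0 hmem0).deriv]
    simp

end Line

/-- The second derivative of the integrand `f` at `x = (p, q)`. -/
noncomputable def integrandHessian (v : ℝ) (w : Plane → Plane) (x : Plane × Plane) :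
    (Plane × Plane) →L[ℝ] (Plane × Plane) →L[ℝ] ℝ :=
  fderiv ℝ (fderiv ℝ fun x : Plane × Plane => integrand v w x.1 x.2) x

/-- The compact set of positions in a ball and velocities of norm between `l / 2` and `2 l`. -/
def speedAnnulus (M l : ℝ) : Set (Plane × Plane) :=
  {x | ‖x.1‖ ≤ M ∧ l / 2 ≤ ‖x.2‖ ∧ ‖x.2‖ ≤ 2 * l}

theorem isCompact_speedAnnulus (M l : ℝ) : IsCompact (speedAnnulus M l) := by
  have hc : IsClosed (speedAnnulus M l) :=
    (isClosed_le continuous_fst.norm continuous_const).inter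
      ((isClosed_le continuous_const continuous_snd.norm).inter
        (isClosed_le continuous_snd.norm continuous_const))
  refine ((isCompact_closedBall (0 : Plane) M).prod
    (isCompact_closedBall (0 : Plane) (2 * l))).of_isClosed_subset hc fun x hx => ?_
  exact ⟨by simpa using hx.1, by simpa using hx.2.2⟩

theorem speedAnnulus_snd_ne_zero {M l : ℝ} (hl : 0 < l) {x : Plane × Plane}
    (hx : x ∈ speedAnnulus M l) : x.2 ≠ 0 := by
  rw [← norm_pos_iff]
  linarith [hx.2.1]

theorem continuousOn_integrandHessian {v : ℝ} {w : Plane → Plane} (hw : ContDiff ℝ 3 w)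
    (hwv : ∀ p, ‖w p‖ < v) {M l : ℝ} (hl : 0 < l) :
    ContinuousOn (integrandHessian v w) (speedAnnulus M l) := fun x hx => by
  have h1 := contDiffAt_integrand hw hwv (speedAnnulus_snd_ne_zero hl hx)
  have h2 : ContDiffAt ℝ 2 (fderiv ℝ fun x : Plane × Plane => integrand v w x.1 x.2) x :=
    h1.fderiv_right (by norm_num)
  have h3 : ContDiffAt ℝ 1 (integrandHessian v w) x := h2.fderiv_right (by norm_num)
  exact h3.continuousAt.continuousWithinAt

/-- The lifted curve `τ ↦ (ξ(τ), ξ_τ(τ))` of a path. -/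
noncomputable def phaseLift (ξ : ℝ → Plane) (τ : ℝ) : Plane × Plane := (ξ τ, deriv ξ τ)

theorem aestronglyMeasurable_phaseLift {xO xD : Plane} {ξ : ℝ → Plane}
    (h : ξ ∈ pathSpace xO xD) : AEStronglyMeasurable (phaseLift ξ) unitMeasure :=
  (pathSpace_aestronglyMeasurable h).prodMk (aestronglyMeasurable_deriv_plane ξ)

theorem phaseLift_bound {xO xD : Plane} {ξ : ℝ → Plane} (h : ξ ∈ pathSpace xO xD) :
    ∃ C : ℝ, 0 < C ∧ ∀ τ ∈ Ioo (0 : ℝ) 1, ‖phaseLift ξ τ‖ ≤ C := by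
  obtain ⟨K, hK0, hK⟩ := pathSpace_norm_deriv_le h
  obtain ⟨M, hM0, hM⟩ := pathSpace_norm_le h
  refine ⟨M + K + 1, by positivity, fun τ hτ => ?_⟩
  rw [phaseLift, Prod.norm_mk]
  exact max_le (by linarith [hM τ hτ]) (by linarith [hK τ hτ])

/-- The flight duration is twice differentiable along lines through a path of speed close to `l`. -/
theorem travelTime_line {v : ℝ} {w : Plane → Plane} (hw : ContDiff ℝ 3 w)
    (hwv : ∀ p, ‖w p‖ < v) {M l : ℝ} (hl : 0 < l) {xO xD : Plane} {ξ δ : ℝ → Plane}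
    (hξ : ξ ∈ pathSpace xO xD) (hδ : δ ∈ dirX)
    (hb : ∀ᵐ τ ∂unitMeasure, ‖ξ τ‖ ≤ M ∧ 3 / 4 * l ≤ ‖deriv ξ τ‖ ∧ ‖deriv ξ τ‖ ≤ 5 / 4 * l) :
    TwiceDifferentiableAt (fun ε : ℝ => travelTime v w (ξ + ε • δ)) 0 ∧
      iteratedDeriv 2 (fun ε : ℝ => travelTime v w (ξ + ε • δ)) 0 =
        ∫ τ, integrandHessian v w (phaseLift ξ τ) (phaseLift δ τ) (phaseLift δ τ)
          ∂unitMeasure := by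
  have hT : (fun ε : ℝ => travelTime v w (ξ + ε • δ)) =
      fun ε => ∫ τ, (fun x : Plane × Plane => integrand v w x.1 x.2)
        (phaseLift ξ τ + ε • phaseLift δ τ) ∂unitMeasure := by
    ext ε
    refine integral_congr_ae ?_
    filter_upwards [ae_deriv_add_smul hξ hδ] with τ h
    simp [phaseLift, h ε]
  obtain ⟨C, hC0, hC⟩ := phaseLift_bound hδ
  have hε₀ : 0 < min 1 (l / 4 / C) := by positivity
  rw [hT]
  refine second_deriv_integral_line (continuous_integrand hw.continuous hwv).measurable
    (isCompact_speedAnnulus (M + C) l)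
    (fun x hx => (contDiffAt_integrand hw hwv (speedAnnulus_snd_ne_zero hl hx)).of_le (by norm_num))
    (aestronglyMeasurable_phaseLift hξ) (aestronglyMeasurable_phaseLift hδ)
    (ae_unitMeasure_mem.mono hC) hε₀ ?_
  filter_upwards [hb, ae_unitMeasure_mem] with τ h hτ ε hε
  have hε' : |ε| < min 1 (l / 4 / C) := abs_lt.2 hε
  have hδ1 : ‖δ τ‖ ≤ C := (norm_fst_le (phaseLift δ τ)).trans (hC τ hτ)
  have hδ2 : ‖deriv δ τ‖ ≤ C := (norm_snd_le (phaseLift δ τ)).trans (hC τ hτ)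
  have h1 : ‖ε • δ τ‖ ≤ C := by
    rw [norm_smul, Real.norm_eq_abs]
    nlinarith [hε'.le.trans (min_le_left _ _), abs_nonneg ε, norm_nonneg (δ τ)]
  have h2 : ‖ε • deriv δ τ‖ ≤ l / 4 := by
    rw [norm_smul, Real.norm_eq_abs]
    have h3 : |ε| ≤ l / 4 / C := hε'.le.trans (min_le_right _ _)
    rw [le_div_iff₀ hC0] at h3
    nlinarith [abs_nonneg ε]
  have h4 := norm_add_le (ξ τ) (ε • δ τ)
  have h5 := norm_add_le (deriv ξ τ) (ε • deriv δ τ)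
  have h6 := norm_sub_le_norm_add (deriv ξ τ) (ε • deriv δ τ)
  refine ⟨?_, ?_, ?_⟩
  · show ‖ξ τ + ε • δ τ‖ ≤ M + C
    linarith [h.1]
  · show l / 2 ≤ ‖deriv ξ τ + ε • deriv δ τ‖
    linarith [h.2.1]
  · show ‖deriv ξ τ + ε • deriv δ τ‖ ≤ 2 * l
    linarith [h.2.2]

/-! ### The Lagrangian along a line -/

theorem memLp_constraintDeriv {xO xD : Plane} {z dz : State} (hz : z ∈ stateSpace xO xD)
    (hdz : dz ∈ dirZ) : MemLp (constraintDeriv z dz) ∞ unitMeasure := by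
  obtain ⟨K, hK0, hK⟩ := pathSpace_norm_deriv_le hz
  obtain ⟨K', hK0', hK'⟩ := pathSpace_norm_deriv_le hdz
  refine memLp_top_of_bound ?_ (2 * (K * K') + |2 * z.1 * dz.1|) ?_
  · exact (((aestronglyMeasurable_deriv_plane _).inner
      (aestronglyMeasurable_deriv_plane _)).const_mul 2).sub aestronglyMeasurable_const
  · filter_upwards [ae_unitMeasure_mem] with τ hτ
    rw [Real.norm_eq_abs, constraintDeriv]
    refine (abs_sub _ _).trans (add_le_add ?_ le_rfl)
    rw [abs_mul, abs_two]
    have := abs_real_inner_le_norm (deriv z.2 τ) (deriv dz.2 τ)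
    have := mul_le_mul (hK τ hτ) (hK' τ hτ) (norm_nonneg _) hK0
    linarith

theorem pairing_eq (l : Multiplier) {g : ℝ → ℝ} (hg : MemLp g ∞ unitMeasure) :
    pairing l g = l (hg.toLp g) := dif_pos hg

/-- The constraint is quadratic, and its quadratic part is again the constraint function. -/
theorem pairing_constraint_line (l : Multiplier) {xO xD : Plane} {z dz : State}
    (hz : z ∈ stateSpace xO xD) (hdz : dz ∈ dirZ) (ε : ℝ) :
    pairing l (constraint (z + ε • dz)) = pairing l (constraint z)
      + ε * pairing l (constraintDeriv z dz) + ε ^ 2 * pairing l (constraint dz) := by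
  have hzε : z + ε • dz ∈ stateSpace xO xD := pathSpace_add_smul hz hdz ε
  have h1 := memLp_constraint hz
  have h2 := memLp_constraintDeriv hz hdz
  have h3 : MemLp (constraint dz) ∞ unitMeasure := memLp_constraint (xO := 0) (xD := 0) hdz
  have h4 := memLp_constraint hzε
  rw [pairing_eq l h1, pairing_eq l h2, pairing_eq l h3, pairing_eq l h4]
  have e : h4.toLp _ = h1.toLp _ + ε • h2.toLp _ + ε ^ 2 • h3.toLp _ := by
    rw [← MemLp.toLp_const_smul, ← MemLp.toLp_const_smul, ← MemLp.toLp_add, ← MemLp.toLp_add,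
      MemLp.toLp_eq_toLp_iff]
    filter_upwards [ae_deriv_add_smul hz hdz] with τ hτ
    have e1 : deriv (z + ε • dz).2 τ = deriv z.2 τ + ε • deriv dz.2 τ := hτ ε
    simp only [constraint, constraintDeriv, Pi.add_apply, Pi.smul_apply, smul_eq_mul, e1,
      Prod.fst_add, Prod.smul_fst]
    rw [norm_add_sq_real, norm_smul, real_inner_smul_right, mul_pow, Real.norm_eq_abs, sq_abs]
    ring
  rw [e, map_add, map_add, map_smul, map_smul, smul_eq_mul, smul_eq_mul]

theorem twiceDifferentiableAt_add_quadratic {φ : ℝ → ℝ} (h : TwiceDifferentiableAt φ 0)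
    (a b c : ℝ) :
    TwiceDifferentiableAt (fun ε => φ ε + (a + ε * b + ε ^ 2 * c)) 0 ∧
      deriv (fun ε => φ ε + (a + ε * b + ε ^ 2 * c)) 0 = deriv φ 0 + b ∧
      iteratedDeriv 2 (fun ε => φ ε + (a + ε * b + ε ^ 2 * c)) 0
        = iteratedDeriv 2 φ 0 + 2 * c := by
  obtain ⟨h1, h2⟩ := h
  have hq : ∀ ε : ℝ, HasDerivAt (fun ε => a + ε * b + ε ^ 2 * c) (b + 2 * ε * c) ε := fun ε => by
    have := (((hasDerivAt_id ε).mul_const b).const_add a).add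
      (((hasDerivAt_id ε).pow 2).mul_const c)
    refine this.congr_deriv ?_
    simp
  have hq' : ∀ ε : ℝ, HasDerivAt (fun ε => b + 2 * ε * c) (2 * c) ε := fun ε => by
    have := ((((hasDerivAt_id ε).const_mul 2).mul_const c).const_add b)
    exact this.congr_deriv (by simp)
  have hd : deriv (fun ε => φ ε + (a + ε * b + ε ^ 2 * c)) =ᶠ[𝓝 0]
      fun ε => deriv φ ε + (b + 2 * ε * c) := by
    filter_upwards [h1] with ε hε
    exact (hε.hasDerivAt.add (hq ε)).deriv
  have h3 : HasDerivAt (fun ε => deriv φ ε + (b + 2 * ε * c)) (deriv (deriv φ) 0 + 2 * c) 0 :=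
    h2.hasDerivAt.add (hq' 0)
  refine ⟨⟨?_, ?_⟩, ?_, ?_⟩
  · filter_upwards [h1] with ε hε
    exact hε.add (hq ε).differentiableAt
  · exact h3.differentiableAt.congr_of_eventuallyEq hd
  · rw [hd.eq_of_nhds]; simp
  · rw [iteratedDeriv_succ, iteratedDeriv_one, hd.deriv_eq, h3.deriv, iteratedDeriv_succ,
      iteratedDeriv_one]

theorem lagrangian_line {v : ℝ} {w : Plane → Plane} {xO xD : Plane} {χ : PrimalDual} {dz : State}
    (hz : χ.1 ∈ stateSpace xO xD) (hdz : dz ∈ dirZ)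
    (hT : TwiceDifferentiableAt (fun ε : ℝ => travelTime v w (χ.1.2 + ε • dz.2)) 0) :
    TwiceDifferentiableAt (lagrangianLine v w χ dz) 0 ∧
      lagrangianZ v w χ dz = deriv (fun ε : ℝ => travelTime v w (χ.1.2 + ε • dz.2)) 0
        + pairing χ.2 (constraintDeriv χ.1 dz) ∧
      lagrangianZZ v w χ dz = travelTimeSecond v w χ.1.2 dz.2
        + 2 * pairing χ.2 (constraint dz) := by
  have e : lagrangianLine v w χ dz = fun ε => travelTime v w (χ.1.2 + ε • dz.2) +
      (pairing χ.2 (constraint χ.1) + ε * pairing χ.2 (constraintDeriv χ.1 dz)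
        + ε ^ 2 * pairing χ.2 (constraint dz)) := by
    ext ε
    rw [lagrangianLine, lagrangian, pairing_constraint_line χ.2 hz hdz ε]
    rfl
  rw [lagrangianZ, lagrangianZZ, travelTimeSecond, e]
  exact twiceDifferentiableAt_add_quadratic hT _ _ _

/-! ### Norms in `L²(]0,1[)` -/

/-- The norm of `L²(]0,1[)`, as a real number. -/
noncomputable def normLTwo {F : Type*} [NormedAddCommGroup F] (f : ℝ → F) : ℝ :=
  (eLpNorm f 2 unitMeasure).toReal

section normLTwo

variable {F G : Type*} [NormedAddCommGroup F] [NormedAddCommGroup G]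

theorem normLTwo_nonneg (f : ℝ → F) : 0 ≤ normLTwo f := ENNReal.toReal_nonneg

theorem memLp_two_of_aebound {f : ℝ → F} (hm : AEStronglyMeasurable f unitMeasure) {C : ℝ}
    (h : ∀ᵐ τ ∂unitMeasure, ‖f τ‖ ≤ C) : MemLp f 2 unitMeasure :=
  (memLp_top_of_bound hm C h).mono_exponent le_top

theorem normLTwo_sq {f : ℝ → F} (hf : MemLp f 2 unitMeasure) :
    normLTwo f ^ 2 = ∫ τ, ‖f τ‖ ^ 2 ∂unitMeasure := by
  have hp : (0 : ℝ) ≤ ∫ τ, ‖f τ‖ ^ 2 ∂unitMeasure := integral_nonneg fun _ => by positivity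
  rw [normLTwo, hf.eLpNorm_eq_integral_rpow_norm (by norm_num) (by norm_num)]
  simp only [ENNReal.toReal_ofNat, Real.rpow_ofNat]
  rw [ENNReal.toReal_ofReal (by positivity), ← Real.rpow_natCast, ← Real.rpow_mul hp]
  norm_num

theorem integral_norm_le_normLTwo {f : ℝ → F} (hf : MemLp f 2 unitMeasure) :
    ∫ τ, ‖f τ‖ ∂unitMeasure ≤ normLTwo f := by
  rw [integral_norm_eq_lintegral_enorm hf.1, ← eLpNorm_one_eq_lintegral_enorm]
  exact ENNReal.toReal_mono hf.2.ne
    (eLpNorm_le_eLpNorm_of_exponent_le (by norm_num) hf.1)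

theorem normLTwo_add_le {f g : ℝ → F} (hf : MemLp f 2 unitMeasure) (hg : MemLp g 2 unitMeasure) :
    normLTwo (f + g) ≤ normLTwo f + normLTwo g := by
  rw [normLTwo, normLTwo, normLTwo, ← ENNReal.toReal_add hf.2.ne hg.2.ne]
  exact ENNReal.toReal_mono (ENNReal.add_ne_top.2 ⟨hf.2.ne, hg.2.ne⟩)
    (eLpNorm_add_le hf.1 hg.1 (by norm_num))

theorem normLTwo_congr {f g : ℝ → F} (h : f =ᵐ[unitMeasure] g) : normLTwo f = normLTwo g := by
  rw [normLTwo, normLTwo, eLpNorm_congr_ae h]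

theorem normLTwo_const (c : F) : normLTwo (fun _ => c) = ‖c‖ := by
  rw [normLTwo, eLpNorm_const _ (by norm_num) (NeZero.ne _)]
  simp

theorem normLTwo_le_of_ae_le {f : ℝ → F} {g : ℝ → G} (hg : MemLp g 2 unitMeasure) {A D : ℝ}
    (hA : 0 ≤ A) (hD : 0 ≤ D) (h : ∀ᵐ τ ∂unitMeasure, ‖f τ‖ ≤ A * ‖g τ‖ + D) :
    normLTwo f ≤ A * normLTwo g + D := by
  have h1 : MemLp (fun τ => A • ‖g τ‖) 2 unitMeasure := hg.norm.const_smul A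
  have h2 : MemLp (fun _ : ℝ => D) 2 unitMeasure := memLp_const D
  have h3 := normLTwo_add_le h1 h2
  have h4 : normLTwo (fun τ => A • ‖g τ‖) = A * normLTwo g := by
    have : normLTwo (A • fun τ => ‖g τ‖) = A * normLTwo g := by
      rw [normLTwo, eLpNorm_const_smul, eLpNorm_norm, ENNReal.toReal_mul, normLTwo]
      simp [abs_of_nonneg hA]
    exact this
  rw [h4, normLTwo_const, Real.norm_of_nonneg hD] at h3
  refine le_trans ?_ h3
  refine ENNReal.toReal_mono (h1.add h2).2.ne (eLpNorm_mono_ae_real ?_)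
  filter_upwards [h] with τ hτ
  exact hτ

end normLTwo

theorem ae_norm_le_of_eLpNorm_top_le {F : Type*} [NormedAddCommGroup F] {f : ℝ → F} {R : ℝ}
    (hR : 0 ≤ R) (h : eLpNorm f ∞ unitMeasure ≤ ENNReal.ofReal R) :
    ∀ᵐ τ ∂unitMeasure, ‖f τ‖ ≤ R := by
  rw [eLpNorm_exponent_top] at h
  filter_upwards [ae_le_eLpNormEssSup (f := f) (μ := unitMeasure)] with τ hτ
  have h1 := hτ.trans h
  rw [← ofReal_norm] at h1
  exact (ENNReal.ofReal_le_ofReal_iff hR).1 h1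

theorem memLp_two_path {xO xD : Plane} {ξ : ℝ → Plane} (h : ξ ∈ pathSpace xO xD) :
    MemLp ξ 2 unitMeasure := by
  obtain ⟨M, -, hM⟩ := pathSpace_norm_le h
  exact memLp_two_of_aebound (pathSpace_aestronglyMeasurable h) (ae_unitMeasure_mem.mono hM)

theorem memLp_two_deriv_path {xO xD : Plane} {ξ : ℝ → Plane} (h : ξ ∈ pathSpace xO xD) :
    MemLp (deriv ξ) 2 unitMeasure := by
  obtain ⟨M, -, hM⟩ := pathSpace_norm_deriv_le h
  exact memLp_two_of_aebound (aestronglyMeasurable_deriv_plane ξ) (ae_unitMeasure_mem.mono hM)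

theorem normZTwo_eq (z : State) : normZTwo z = |z.1| + normLTwo z.2 + normLTwo (deriv z.2) := rfl

theorem normZTwo_nonneg (z : State) : 0 ≤ normZTwo z :=
  add_nonneg (add_nonneg (abs_nonneg _) ENNReal.toReal_nonneg) ENNReal.toReal_nonneg

theorem dirZ_add {x c : State} (hx : x ∈ dirZ) (hc : c ∈ dirZ) : x + c ∈ dirZ := by
  have := pathSpace_add_smul hx hc 1
  rw [one_smul] at this
  exact this

theorem dirZ_ae_deriv_add {x c : State} (hx : x ∈ dirZ) (hc : c ∈ dirZ) :
    ∀ᵐ τ ∂unitMeasure, deriv (x + c).2 τ = deriv x.2 τ + deriv c.2 τ := by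
  filter_upwards [ae_deriv_add_smul hx hc] with τ hτ
  simpa using hτ 1

theorem normZTwo_add_le {x c : State} (hx : x ∈ dirZ) (hc : c ∈ dirZ) :
    normZTwo (x + c) ≤ normZTwo x + normZTwo c := by
  have h1 := normLTwo_add_le (memLp_two_path hx) (memLp_two_path hc)
  have h2 := normLTwo_add_le (memLp_two_deriv_path hx) (memLp_two_deriv_path hc)
  have h3 : normLTwo (deriv (x + c).2) = normLTwo (deriv x.2 + deriv c.2) :=
    normLTwo_congr (dirZ_ae_deriv_add hx hc)
  have h4 : |(x + c).1| ≤ |x.1| + |c.1| := abs_add_le _ _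
  rw [normZTwo_eq, normZTwo_eq, normZTwo_eq, h3]
  have h5 : normLTwo (x + c).2 = normLTwo (x.2 + c.2) := rfl
  linarith

theorem le_normZTwo_of_add {x c : State} (hx : x ∈ dirZ) (hc : c ∈ dirZ) :
    normZTwo x ≤ normZTwo (x + c) + normZTwo c := by
  have hneg : (-c) ∈ dirZ := by
    have := pathSpace_add_smul (xO := 0) (xD := 0) (ξ := 0) (δ := c.2)
      ⟨⟨0, (LipschitzWith.const 0).lipschitzOnWith⟩, rfl, rfl⟩ hc (-1)
    simpa [dirZ, dirX] using this
  have h1 := normZTwo_add_le (dirZ_add hx hc) hneg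
  have h2 : normZTwo (-c) = normZTwo c := by
    simp only [normZTwo, Prod.fst_neg, abs_neg, Prod.snd_neg, eLpNorm_neg]
    have : deriv (-c.2) = -deriv c.2 := by
      ext1 τ; exact deriv.neg
    rw [this, eLpNorm_neg]
  rw [h2, add_neg_cancel_right] at h1
  exact h1

/-- The squared Hilbert space norm of `δz` is bounded by the square of `‖δz‖_{Z2}`. -/
theorem sq_add_integral_le_normZTwo_sq {x : State} (hx : x ∈ dirZ) :
    x.1 ^ 2 + ∫ τ, ‖x.2 τ‖ ^ 2 ∂unitMeasure + ∫ τ, ‖deriv x.2 τ‖ ^ 2 ∂unitMeasure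
      ≤ normZTwo x ^ 2 := by
  rw [← normLTwo_sq (memLp_two_path hx), ← normLTwo_sq (memLp_two_deriv_path hx), normZTwo_eq,
    ← sq_abs x.1]
  have h1 := abs_nonneg x.1
  have h2 := normLTwo_nonneg x.2
  have h3 := normLTwo_nonneg (deriv x.2)
  nlinarith [mul_nonneg h1 h2, mul_nonneg h1 h3, mul_nonneg h2 h3]

theorem integral_phaseLift_sq_le {x : State} (hx : x ∈ dirZ) :
    ∫ τ, ‖phaseLift x.2 τ‖ ^ 2 ∂unitMeasure ≤ normZTwo x ^ 2 := by
  have i1 : Integrable (fun τ => ‖x.2 τ‖ ^ 2) unitMeasure := (memLp_two_path hx).integrable_norm_pow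
    (by norm_num)
  have i2 : Integrable (fun τ => ‖deriv x.2 τ‖ ^ 2) unitMeasure :=
    (memLp_two_deriv_path hx).integrable_norm_pow (by norm_num)
  have h1 : ∫ τ, ‖phaseLift x.2 τ‖ ^ 2 ∂unitMeasure
      ≤ ∫ τ, (‖x.2 τ‖ ^ 2 + ‖deriv x.2 τ‖ ^ 2) ∂unitMeasure := by
    refine integral_mono_of_nonneg (Eventually.of_forall fun _ => by positivity) (i1.add i2)
      (Eventually.of_forall fun τ => ?_)
    simp only [phaseLift, Prod.norm_mk]
    rcases max_cases ‖x.2 τ‖ ‖deriv x.2 τ‖ with h | h <;> rw [h.1] <;>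
      nlinarith [sq_nonneg ‖x.2 τ‖, sq_nonneg ‖deriv x.2 τ‖]
  rw [integral_add i1 i2] at h1
  have := sq_add_integral_le_normZTwo_sq hx
  nlinarith [sq_nonneg x.1]

/-! ### A bounded right inverse of the linearized constraint -/

/-- For a field `e` of unit vectors with mean `b ≠ 0`, the self-adjoint operator
`y ↦ ⟨b, y⟩ b + ∫ (y - ⟨e, y⟩ e)` is positive definite, hence invertible. -/
theorem exists_solution_mean_operator {e : ℝ → Plane} (hm : AEStronglyMeasurable e unitMeasure)
    (he : ∀ᵐ τ ∂unitMeasure, ‖e τ‖ = 1) (hb : ∫ τ, e τ ∂unitMeasure ≠ 0) :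
    ∃ C : ℝ, 0 ≤ C ∧ ∀ d : Plane, ∃ y : Plane, ‖y‖ ≤ C * ‖d‖ ∧
      inner ℝ (∫ τ, e τ ∂unitMeasure) y • (∫ τ, e τ ∂unitMeasure)
        + ∫ τ, (y - (inner ℝ (e τ) y : ℝ) • e τ) ∂unitMeasure = d := by
  set b := ∫ τ, e τ ∂unitMeasure with hbdef
  have hei : Integrable e unitMeasure := integrable_of_aebound hm (he.mono fun _ h => h.le)
  have hint : ∀ y : Plane, Integrable (fun τ => y - (inner ℝ (e τ) y : ℝ) • e τ) unitMeasure := by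
    intro y
    have hmy : AEStronglyMeasurable (fun τ => (inner ℝ (e τ) y : ℝ) • e τ) unitMeasure :=
      (hm.inner (𝕜 := ℝ) aestronglyMeasurable_const).smul hm
    refine (integrable_const y).sub (integrable_of_aebound hmy (C := ‖y‖) ?_)
    filter_upwards [he] with τ h
    rw [norm_smul, h, mul_one]
    simpa [h] using norm_inner_le_norm (𝕜 := ℝ) (e τ) y
  let A : Plane →ₗ[ℝ] Plane :=
    { toFun := fun y => inner ℝ b y • b + ∫ τ, (y - (inner ℝ (e τ) y : ℝ) • e τ) ∂unitMeasure
      map_add' := fun y y' => by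
        have : ∀ τ, (y + y') - (inner ℝ (e τ) (y + y') : ℝ) • e τ
            = (y - (inner ℝ (e τ) y : ℝ) • e τ) + (y' - (inner ℝ (e τ) y' : ℝ) • e τ) := fun τ => by
          rw [inner_add_right, add_smul]; abel
        simp only [this]
        rw [integral_add (hint y) (hint y'), inner_add_right, add_smul]
        abel
      map_smul' := fun c y => by
        have : ∀ τ, c • y - (inner ℝ (e τ) (c • y) : ℝ) • e τ
            = c • (y - (inner ℝ (e τ) y : ℝ) • e τ) := fun τ => by
          rw [inner_smul_right, smul_sub, smul_smul]
        simp only [this]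
        rw [integral_smul, inner_smul_right, mul_smul, smul_add, RingHom.id_apply] }
  have hA : ∀ y, A y = inner ℝ b y • b + ∫ τ, (y - (inner ℝ (e τ) y : ℝ) • e τ) ∂unitMeasure :=
    fun y => rfl
  have hinj : Function.Injective A := by
    rw [← LinearMap.ker_eq_bot, LinearMap.ker_eq_bot']
    intro y hy
    have hnn : ∀ᵐ τ ∂unitMeasure, 0 ≤ inner ℝ y (y - (inner ℝ (e τ) y : ℝ) • e τ) := by
      filter_upwards [he] with τ h
      rw [inner_sub_right, real_inner_self_eq_norm_sq, real_inner_smul_right,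
        real_inner_comm (e τ) y]
      have h1 := abs_real_inner_le_norm (e τ) y
      rw [h, one_mul] at h1
      have := sq_le_sq' (by linarith [abs_le.1 h1]) (abs_le.1 h1).2
      nlinarith
    have h1 : inner ℝ y (A y) = (inner ℝ b y) ^ 2
        + ∫ τ, inner ℝ y (y - (inner ℝ (e τ) y : ℝ) • e τ) ∂unitMeasure := by
      rw [hA, inner_add_right, real_inner_smul_right, real_inner_comm y b, integral_inner (hint y),
        real_inner_comm b y]
      ring
    have h2 := integral_nonneg_of_ae hnn
    rw [hy, inner_zero_right] at h1
    have h3 : inner ℝ b y = 0 := by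
      have : (inner ℝ b y) ^ 2 = 0 := by nlinarith [sq_nonneg (inner ℝ b y)]
      exact pow_eq_zero_iff (two_ne_zero) |>.1 this
    have h4 : ∫ τ, inner ℝ y (y - (inner ℝ (e τ) y : ℝ) • e τ) ∂unitMeasure = 0 := by
      rw [h3] at h1; linarith
    rw [integral_eq_zero_iff_of_nonneg_ae hnn ((hint y).const_inner y)] at h4
    -- Equality in the Cauchy-Schwarz inequality: `e` is parallel to `y` almost everywhere.
    have h5 : ∀ᵐ τ ∂unitMeasure, (‖y‖ ^ 2) • e τ = (inner ℝ (e τ) y : ℝ) • y := by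
      filter_upwards [h4, he] with τ h h'
      rw [inner_sub_right, real_inner_self_eq_norm_sq, real_inner_smul_right,
        real_inner_comm (e τ) y] at h
      simp only [Pi.zero_apply] at h
      rw [← sub_eq_zero, ← norm_eq_zero, ← pow_eq_zero_iff (two_ne_zero), norm_sub_sq_real,
        norm_smul, norm_smul, real_inner_smul_left, real_inner_smul_right, h', mul_pow, mul_pow,
        Real.norm_eq_abs, Real.norm_eq_abs, sq_abs, sq_abs]
      linear_combination (‖y‖ ^ 2) * h
    have h6 : (‖y‖ ^ 2) • b = (inner ℝ b y : ℝ) • y := by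
      have h7 := integral_congr_ae h5
      rw [integral_smul, integral_smul_const] at h7
      have h8 : ∫ τ, (inner ℝ (e τ) y : ℝ) ∂unitMeasure = inner ℝ b y := by
        simp only [real_inner_comm y]
        rw [integral_inner hei]
      rw [h7, h8]
    rw [h3, zero_smul, smul_eq_zero] at h6
    rcases h6 with h6 | h6
    · simpa using h6
    · exact absurd h6 hb
  let Ae := LinearEquiv.ofInjectiveEndo A hinj
  let Ai : Plane →L[ℝ] Plane := LinearMap.toContinuousLinearMap (Ae.symm : Plane →ₗ[ℝ] Plane)
  refine ⟨‖Ai‖, norm_nonneg _, fun d => ⟨Ai d, Ai.le_opNorm d, ?_⟩⟩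
  rw [← hA]
  exact Ae.apply_symm_apply d

/-- The linearized constraint at an admissible state maps `δZ` onto `L^∞(]0,1[)`, with a right
inverse bounded with respect to the `L²` norms. With `e = ξ_τ / L`, the tangential part of `δξ_τ` is
prescribed by `δL` and the right-hand side `g`; the normal part is that of a constant vector `y`,
and `δL = ⟨∫ e, y⟩`, where `y` is chosen so that `δξ_τ` has mean zero. -/
theorem exists_linearized_constraint_eq {xO xD : Plane} (hne : xO ≠ xD) {z : State}
    (hz : z ∈ stateSpace xO xD) (hc : ∀ᵐ τ ∂unitMeasure, ‖deriv z.2 τ‖ ^ 2 = z.1 ^ 2)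
    (hL : z.1 ≠ 0) :
    ∃ C : ℝ, 0 ≤ C ∧ ∀ g : ℝ → ℝ, MemLp g ∞ unitMeasure → ∃ c ∈ dirZ,
      (∀ᵐ τ ∂unitMeasure, inner ℝ (deriv z.2 τ) (deriv c.2 τ) - z.1 * c.1 = g τ) ∧
      normZTwo c ≤ C * normLTwo g := by
  obtain ⟨e, he_def⟩ : ∃ e : ℝ → Plane, e = fun τ => z.1⁻¹ • deriv z.2 τ := ⟨_, rfl⟩
  have hL' : 0 < |z.1| := abs_pos.2 hL
  have hem : AEStronglyMeasurable e unitMeasure := by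
    rw [he_def]
    exact (aestronglyMeasurable_deriv_plane z.2).const_smul z.1⁻¹
  have he : ∀ᵐ τ ∂unitMeasure, ‖e τ‖ = 1 := by
    filter_upwards [hc] with τ h
    have h4 : ‖deriv z.2 τ‖ = |z.1| := by
      rw [← abs_of_nonneg (norm_nonneg (deriv z.2 τ)), ← sq_eq_sq_iff_abs_eq_abs]; exact h
    rw [he_def]
    simp only
    rw [norm_smul, h4, norm_inv, Real.norm_eq_abs, inv_mul_cancel₀ hL'.ne']
  have hei : Integrable e unitMeasure := integrable_of_aebound hem (he.mono fun _ h => h.le)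
  have hb : ∫ τ, e τ ∂unitMeasure ≠ 0 := by
    rw [he_def, integral_smul, integral_deriv_pathSpace hz]
    exact smul_ne_zero (inv_ne_zero hL) (sub_ne_zero.2 hne.symm)
  obtain ⟨CA, hCA, hsol⟩ := exists_solution_mean_operator hem he hb
  set b := ∫ τ, e τ ∂unitMeasure with hbdef
  have hb1 : ‖b‖ ≤ 1 := by
    have := norm_integral_le_of_norm_le_const (μ := unitMeasure) (he.mono fun _ h => h.le)
    simpa using this
  refine ⟨(2 + 7 * CA) / |z.1|, by positivity, fun g hg => ?_⟩
  have hg2 : MemLp g 2 unitMeasure := hg.mono_exponent le_top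
  obtain ⟨Cg, hCg⟩ : ∃ Cg : ℝ, ∀ᵐ τ ∂unitMeasure, ‖g τ‖ ≤ Cg :=
    ⟨_, ae_norm_le_of_eLpNorm_top_le ENNReal.toReal_nonneg (ENNReal.ofReal_toReal hg.2.ne).ge⟩
  obtain ⟨y, hyn, hy⟩ := hsol (-∫ τ, (g τ / z.1) • e τ ∂unitMeasure)
  set G := normLTwo g with hG
  have hG0 : 0 ≤ G := normLTwo_nonneg g
  have hgi : Integrable (fun τ => (g τ / z.1) • e τ) unitMeasure := by
    have hgm : AEStronglyMeasurable (fun τ => g τ / z.1) unitMeasure := by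
      simpa only [div_eq_mul_inv] using hg.1.mul_const z.1⁻¹
    refine integrable_of_aebound (hgm.smul hem) (C := Cg / |z.1|) ?_
    filter_upwards [he, hCg] with τ h h'
    show ‖(g τ / z.1) • e τ‖ ≤ _
    rw [norm_smul, h, mul_one, norm_div, Real.norm_eq_abs z.1]
    gcongr
  have hgn : ‖∫ τ, (g τ / z.1) • e τ ∂unitMeasure‖ ≤ G / |z.1| := by
    refine (norm_integral_le_integral_norm _).trans ?_
    have : ∫ τ, ‖(g τ / z.1) • e τ‖ ∂unitMeasure = ∫ τ, ‖g τ‖ / |z.1| ∂unitMeasure := by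
      refine integral_congr_ae ?_
      filter_upwards [he] with τ h
      rw [norm_smul, h, mul_one, norm_div, Real.norm_eq_abs z.1]
    rw [this, integral_div]
    have := integral_norm_le_normLTwo hg2
    gcongr
  have hy' : ‖y‖ ≤ CA * (G / |z.1|) := by
    rw [norm_neg] at hyn
    exact hyn.trans (mul_le_mul_of_nonneg_left hgn hCA)
  set dL : ℝ := inner ℝ b y with hdL
  have hdL' : |dL| ≤ ‖y‖ := by
    refine (abs_real_inner_le_norm b y).trans ?_
    nlinarith [norm_nonneg y]
  set u : ℝ → Plane := fun τ => ((g τ / z.1) • e τ + dL • e τ)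
    + (y - (inner ℝ (e τ) y : ℝ) • e τ) with hu
  have hum1 : AEStronglyMeasurable (fun τ => y - (inner ℝ (e τ) y : ℝ) • e τ) unitMeasure :=
    aestronglyMeasurable_const.sub ((hem.inner (𝕜 := ℝ) aestronglyMeasurable_const).smul hem)
  have hproj : ∀ᵐ τ ∂unitMeasure, ‖y - (inner ℝ (e τ) y : ℝ) • e τ‖ ≤ 2 * ‖y‖ := by
    filter_upwards [he] with τ h
    refine (norm_sub_le _ _).trans ?_
    rw [norm_smul, h, mul_one]
    have : ‖(inner ℝ (e τ) y : ℝ)‖ ≤ ‖y‖ := by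
      simpa [h] using norm_inner_le_norm (𝕜 := ℝ) (e τ) y
    linarith
  have hum : AEStronglyMeasurable u unitMeasure := (hgi.1.add (hem.const_smul dL)).add hum1
  have hun : ∀ᵐ τ ∂unitMeasure, ‖u τ‖ ≤ |z.1|⁻¹ * ‖g τ‖ + 3 * ‖y‖ := by
    filter_upwards [he, hproj] with τ h h'
    refine (norm_add_le _ _).trans ?_
    have h1 : ‖(g τ / z.1) • e τ + dL • e τ‖ ≤ |z.1|⁻¹ * ‖g τ‖ + |dL| := by
      refine (norm_add_le _ _).trans ?_
      rw [norm_smul, norm_smul, h, mul_one, mul_one, norm_div, Real.norm_eq_abs z.1,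
        Real.norm_eq_abs dL, div_eq_inv_mul]
    linarith
  have hub : ∀ᵐ τ ∂unitMeasure, ‖u τ‖ ≤ |z.1|⁻¹ * Cg + 3 * ‖y‖ := by
    filter_upwards [hun, hCg] with τ h h'
    have := mul_le_mul_of_nonneg_left h' (inv_nonneg.2 hL'.le)
    linarith
  have hu0 : ∫ τ, u τ ∂unitMeasure = 0 := by
    have i3 : Integrable (fun τ => y - (inner ℝ (e τ) y : ℝ) • e τ) unitMeasure :=
      integrable_of_aebound hum1 hproj
    have i2 : Integrable (fun τ => dL • e τ) unitMeasure := hei.smul dL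
    have i12 : Integrable (fun τ => (g τ / z.1) • e τ + dL • e τ) unitMeasure := hgi.add i2
    simp only [hu]
    rw [integral_add i12 i3, integral_add hgi i2, integral_smul, add_assoc, hy, add_neg_cancel]
  obtain ⟨δ, hδ, hδ', hδn⟩ := exists_dirX_deriv_eq hum hub hu0
  refine ⟨(dL, δ), hδ, ?_, ?_⟩
  · filter_upwards [hδ', he] with τ h h'
    have hd : deriv z.2 τ = z.1 • e τ := by
      rw [he_def]; simp only; rw [smul_smul, mul_inv_cancel₀ hL, one_smul]
    show inner ℝ (deriv z.2 τ) (deriv δ τ) - z.1 * dL = g τ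
    rw [h, hd, hu]
    simp only
    simp only [real_inner_smul_left, inner_add_right, inner_sub_right, real_inner_smul_right,
      real_inner_self_eq_norm_sq, h']
    field_simp
    ring
  · have hu2 : normLTwo u ≤ |z.1|⁻¹ * G + 3 * ‖y‖ :=
      normLTwo_le_of_ae_le hg2 (by positivity) (by positivity) hun
    have hd2 : normLTwo (deriv δ) = normLTwo u := normLTwo_congr hδ'
    have hδ2 : normLTwo δ ≤ normLTwo u := by
      have hi := integral_norm_le_normLTwo (memLp_two_of_aebound hum hub)
      have h0 : MemLp (fun _ : ℝ => (0 : ℝ)) 2 unitMeasure := memLp_const 0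
      have := normLTwo_le_of_ae_le (f := δ) h0 le_rfl (normLTwo_nonneg u) (by
        filter_upwards [ae_unitMeasure_mem] with τ hτ
        have := hδn τ hτ
        simp only [norm_zero, mul_zero, zero_add]
        linarith)
      simpa using this
    rw [normZTwo_eq]
    show |dL| + normLTwo δ + normLTwo (deriv δ) ≤ _
    rw [hd2]
    have e1 : (2 + 7 * CA) / |z.1| * G = 2 * (|z.1|⁻¹ * G) + 7 * (CA * (G / |z.1|)) := by
      field_simp
    rw [e1]
    linarith

/-! ### Nondegeneracy of the global solution -/

theorem norm_deriv_eq_of_sq_eq {z : State} {τ : ℝ} (h : ‖deriv z.2 τ‖ ^ 2 = z.1 ^ 2) :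
    ‖deriv z.2 τ‖ = |z.1| := by
  rw [← abs_of_nonneg (norm_nonneg (deriv z.2 τ)), ← sq_eq_sq_iff_abs_eq_abs]
  exact h

theorem integrable_integrand_path {v : ℝ} {w : Plane → Plane} (hw : Continuous w)
    (hwv : ∀ p, ‖w p‖ < v) {xO xD : Plane} {ξ : ℝ → Plane} (hξ : ξ ∈ pathSpace xO xD) :
    Integrable (fun τ => integrand v w (ξ τ) (deriv ξ τ)) unitMeasure := by
  have hc := continuous_integrand hw hwv
  obtain ⟨C, -, hC⟩ := phaseLift_bound hξ
  obtain ⟨D, hD⟩ := (isCompact_closedBall (0 : Plane × Plane) C).exists_bound_of_continuousOn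
    hc.continuousOn
  have hm := hc.comp_aestronglyMeasurable (aestronglyMeasurable_phaseLift hξ)
  have hb : ∀ᵐ τ ∂unitMeasure, ‖integrand v w (phaseLift ξ τ).1 (phaseLift ξ τ).2‖ ≤ D := by
    filter_upwards [ae_unitMeasure_mem] with τ hτ
    exact hD (phaseLift ξ τ) (mem_closedBall_zero_iff.2 (hC τ hτ))
  exact integrable_of_aebound hm hb

/-- If the end points coincide, then the only global solutions are stationary. -/
theorem deriv_eq_zero_of_endpoints_eq {v : ℝ} {w : Plane → Plane} (hw : Continuous w)
    (hwv : ∀ p, ‖w p‖ < v) {x : Plane} {z : State} (hz : IsGlobalSolution v w x x z) :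
    z.1 = 0 ∧ ∀ᵐ τ ∂unitMeasure, deriv z.2 τ = 0 := by
  obtain ⟨hzX, hc, hmin⟩ := hz
  have h1 : travelTime v w z.2 ≤ 0 := by
    have := hmin (0, fun _ => x) ⟨⟨0, (LipschitzWith.const x).lipschitzOnWith⟩, rfl, rfl⟩
      (Eventually.of_forall fun τ => by simp)
    refine this.trans (le_of_eq ?_)
    simp [travelTime, integrand]
  have h2 : 0 ≤ᵐ[unitMeasure] fun τ => integrand v w (z.2 τ) (deriv z.2 τ) :=
    Eventually.of_forall fun τ => integrand_nonneg hwv _ _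
  have h3 : travelTime v w z.2 = 0 := le_antisymm h1 (integral_nonneg_of_ae h2)
  have h4 := (integral_eq_zero_iff_of_nonneg_ae h2 (integrable_integrand_path hw hwv hzX)).1 h3
  have h5 : ∀ᵐ τ ∂unitMeasure, deriv z.2 τ = 0 := by
    filter_upwards [h4] with τ h
    by_contra hne
    exact (integrand_pos hwv (z.2 τ) hne).ne' h
  refine ⟨?_, h5⟩
  obtain ⟨τ, h6, h7⟩ := (h5.and hc).exists
  rw [h6, norm_zero] at h7
  exact (pow_eq_zero_iff two_ne_zero).1 (by rw [← h7]; norm_num)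

/-- The inf-sup condition excludes coinciding end points, for which the linearized constraint
vanishes identically. -/
theorem endpoints_ne_of_infSup {v : ℝ} {w : Plane → Plane} (hw : Continuous w)
    (hwv : ∀ p, ‖w p‖ < v) {xO xD : Plane} {z : State} (hz : IsGlobalSolution v w xO xD z)
    (h : InfSupCondition z) : xO ≠ xD := by
  rintro rfl
  obtain ⟨hL, hd⟩ := deriv_eq_zero_of_endpoints_eq hw hwv hz
  obtain ⟨κ, hκ, hle⟩ := h
  have h1 : eLpNorm (fun _ : ℝ => (1 : ℝ)) 2 unitMeasure ≠ 0 := by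
    rw [eLpNorm_const _ (by norm_num) (NeZero.ne _)]
    simp
  have h2 := hle.trans (iInf_le_of_le (fun _ => 1) (iInf_le_of_le (memLp_const 1)
    (iInf_le_of_le h1 le_rfl)))
  have h3 : (κ : EReal) ≤ ((0 : ℝ) : EReal) := by
    refine h2.trans (iSup_le fun dz => iSup_le fun _ => iSup_le fun _ => ?_)
    have h4 : ∫ τ, 1 * constraintDeriv z dz τ ∂unitMeasure = 0 := by
      rw [← integral_zero ℝ ℝ (μ := unitMeasure)]
      refine integral_congr_ae ?_
      filter_upwards [hd] with τ hτ
      simp [constraintDeriv, hτ, hL]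
    rw [h4, zero_div]
  exact absurd (EReal.coe_le_coe_iff.1 h3) (not_le.2 hκ)

theorem length_ne_zero {xO xD : Plane} (hne : xO ≠ xD) {z : State}
    (hz : z ∈ stateSpace xO xD) (hc : ∀ᵐ τ ∂unitMeasure, ‖deriv z.2 τ‖ ^ 2 = z.1 ^ 2) :
    z.1 ≠ 0 := by
  intro h0
  have h1 : ∫ τ, deriv z.2 τ ∂unitMeasure = 0 := by
    rw [← integral_zero ℝ Plane (μ := unitMeasure)]
    refine integral_congr_ae ?_
    filter_upwards [hc] with τ hτ
    have := norm_deriv_eq_of_sq_eq hτ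
    rwa [h0, abs_zero, norm_eq_zero] at this
  rw [integral_deriv_pathSpace hz, sub_eq_zero] at h1
  exact hne h1.symm

/-- The multiplier of a global solution vanishes: the constraint only fixes the parametrization,
on which the flight duration does not depend. -/
theorem multiplier_eq_zero {v : ℝ} {w : Plane → Plane} (hw : ContDiff ℝ 3 w)
    (hwv : ∀ p, ‖w p‖ < v) {xO xD : Plane} (hne : xO ≠ xD) {χ : PrimalDual}
    (hglob : IsGlobalSolution v w xO xD χ.1) (hnec : NecessaryConditions v w χ) : χ.2 = 0 := by
  have hz := hglob.1
  have hc := hglob.2.1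
  have hL := length_ne_zero hne hz hc
  have hL' : 0 < |χ.1.1| := abs_pos.2 hL
  obtain ⟨M, -, hM⟩ := pathSpace_norm_le hz
  obtain ⟨C, -, hsol⟩ := exists_linearized_constraint_eq hne hz hc hL
  ext g
  obtain ⟨c, hcZ, hcg, -⟩ := hsol (fun τ => g τ) (Lp.memLp g)
  have hT := (travelTime_line hw hwv hL' (M := M) hz hcZ (by
    filter_upwards [hc, ae_unitMeasure_mem] with τ h hτ
    rw [norm_deriv_eq_of_sq_eq h]
    exact ⟨hM τ hτ, by linarith, by linarith⟩)).1
  have h1 := hnec.1 c hcZ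
  rw [(lagrangian_line hz hcZ hT).2.1,
    (isLocalMin_travelTime_line hglob hL hcZ).deriv_eq_zero, zero_add,
    pairing_eq _ (memLp_constraintDeriv hz hcZ)] at h1
  have h2 : (memLp_constraintDeriv hz hcZ).toLp _ = (2 : ℝ) • g := by
    rw [← Lp.toLp_coeFn ((2 : ℝ) • g) (Lp.memLp _), MemLp.toLp_eq_toLp_iff]
    filter_upwards [hcg, Lp.coeFn_smul (2 : ℝ) g] with τ h h'
    rw [h', Pi.smul_apply, smul_eq_mul, ← h, constraintDeriv]
    ring
  rw [h2, map_smul, smul_eq_mul] at h1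
  simpa using h1

/-! ### Quadratic estimates -/

/-- Replacing `x` by `x + c` in a bounded quadratic form; the mixed term is split by Young's
inequality with weight `θ`. -/
theorem quadratic_form_perturbation {E : Type*} [NormedAddCommGroup E] [NormedSpace ℝ E]
    (A : E →L[ℝ] E →L[ℝ] ℝ) {C θ : ℝ} (hC : ‖A‖ ≤ C) (hθ : 0 < θ) (x c : E) :
    A (x + c) (x + c) - C * θ * ‖x + c‖ ^ 2 - C * (1 + 1 / θ) * ‖c‖ ^ 2 ≤ A x x := by
  have hC0 : 0 ≤ C := (norm_nonneg A).trans hC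
  have hb : ∀ a b : E, |A a b| ≤ C * ‖a‖ * ‖b‖ := fun a b =>
    (A.le_opNorm₂ a b).trans (by gcongr)
  have e : A x x = A (x + c) (x + c) - A (x + c) c - A c (x + c) + A c c := by
    simp only [map_add, add_apply]
    ring
  have h1 := abs_le.1 (hb (x + c) c)
  have h2 := abs_le.1 (hb c (x + c))
  have h3 := abs_le.1 (hb c c)
  have h4 : 2 * (‖x + c‖ * ‖c‖) ≤ θ * ‖x + c‖ ^ 2 + 1 / θ * ‖c‖ ^ 2 := by
    have h5 : 0 ≤ 1 / θ * (θ * ‖x + c‖ - ‖c‖) ^ 2 := by positivity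
    have h6 : 1 / θ * (θ * ‖x + c‖ - ‖c‖) ^ 2
        = θ * ‖x + c‖ ^ 2 - 2 * (‖x + c‖ * ‖c‖) + 1 / θ * ‖c‖ ^ 2 := by
      field_simp
      ring
    linarith
  have h7 := mul_le_mul_of_nonneg_left h4 hC0
  rw [e]
  nlinarith

theorem integrandHessian_uniform {v : ℝ} {w : Plane → Plane} (hw : ContDiff ℝ 3 w)
    (hwv : ∀ p, ‖w p‖ < v) (M : ℝ) {l : ℝ} (hl : 0 < l) {ω : ℝ} (hω : 0 < ω) :
    ∃ ρ > 0, ∀ x ∈ speedAnnulus M l, ∀ y ∈ speedAnnulus M l, dist x y < ρ →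
      ‖integrandHessian v w x - integrandHessian v w y‖ ≤ ω := by
  have h := (isCompact_speedAnnulus M l).uniformContinuousOn_of_continuous
    (f := integrandHessian v w)
    (continuousOn_integrandHessian hw hwv hl)
  obtain ⟨ρ, hρ, h'⟩ := (Metric.uniformContinuousOn_iff (f := integrandHessian v w)).1 h ω hω
  exact ⟨ρ, hρ, fun x hx y hy hxy => (dist_eq_norm (integrandHessian v w x)
    (integrandHessian v w y)).symm.trans_le (h' x hx y hy hxy).le⟩

theorem integrable_phaseLift_sq {x : State} (hx : x ∈ dirZ) :
    Integrable (fun τ => ‖phaseLift x.2 τ‖ ^ 2) unitMeasure := by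
  obtain ⟨C, -, hC⟩ := phaseLift_bound hx
  exact (memLp_two_of_aebound (aestronglyMeasurable_phaseLift hx)
    (ae_unitMeasure_mem.mono hC)).integrable_norm_pow (by norm_num)

theorem integrable_integrandHessian (v : ℝ) (w : Plane → Plane) {xO xD : Plane} {ξ : ℝ → Plane}
    (hξ : ξ ∈ pathSpace xO xD) {C : ℝ}
    (hC : ∀ᵐ τ ∂unitMeasure, ‖integrandHessian v w (phaseLift ξ τ)‖ ≤ C) {x : State}
    (hx : x ∈ dirZ) :
    Integrable (fun τ => integrandHessian v w (phaseLift ξ τ) (phaseLift x.2 τ)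
      (phaseLift x.2 τ)) unitMeasure := by
  refine ((integrable_phaseLift_sq hx).const_mul C).mono'
    (aestronglyMeasurable_second_fderiv _ (aestronglyMeasurable_phaseLift hξ)
      (aestronglyMeasurable_phaseLift hx)) ?_
  filter_upwards [hC] with τ h
  refine ((integrandHessian v w (phaseLift ξ τ)).le_opNorm₂ _ _).trans ?_
  rw [mul_assoc, ← sq]
  gcongr

/-- The integrated form of `quadratic_form_perturbation`, at a fixed base path. -/
theorem integral_hessian_perturbation (v : ℝ) (w : Plane → Plane) {xO xD : Plane} {ξ : ℝ → Plane}
    (hξ : ξ ∈ pathSpace xO xD) {C : ℝ} (hC0 : 0 ≤ C)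
    (hC : ∀ᵐ τ ∂unitMeasure, ‖integrandHessian v w (phaseLift ξ τ)‖ ≤ C) {θ : ℝ} (hθ : 0 < θ)
    {x c : State} (hx : x ∈ dirZ) (hc : c ∈ dirZ) :
    (∫ τ, integrandHessian v w (phaseLift ξ τ) (phaseLift (x + c).2 τ)
        (phaseLift (x + c).2 τ) ∂unitMeasure)
      - C * θ * normZTwo (x + c) ^ 2 - C * (1 + 1 / θ) * normZTwo c ^ 2 ≤
    ∫ τ, integrandHessian v w (phaseLift ξ τ) (phaseLift x.2 τ) (phaseLift x.2 τ)
      ∂unitMeasure := by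
  have hxc := dirZ_add hx hc
  have i1 := integrable_integrandHessian v w hξ hC hxc
  have i2 := (integrable_phaseLift_sq hxc).const_mul (C * θ)
  have i3 := (integrable_phaseLift_sq hc).const_mul (C * (1 + 1 / θ))
  have h := integral_mono_ae ((i1.sub i2).sub i3) (integrable_integrandHessian v w hξ hC hx) (by
    filter_upwards [hC, dirZ_ae_deriv_add hx hc] with τ h1 h2
    have e : phaseLift (x + c).2 τ = phaseLift x.2 τ + phaseLift c.2 τ := by
      simp only [phaseLift, h2, Prod.mk_add_mk]
      rfl
    simp only [Pi.sub_apply, e]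
    exact quadratic_form_perturbation _ h1 hθ _ _)
  rw [integral_sub' (i1.sub i2) i3, integral_sub' i1 i2, integral_const_mul,
    integral_const_mul] at h
  have h4 := mul_le_mul_of_nonneg_left (integral_phaseLift_sq_le hxc) (mul_nonneg hC0 hθ.le)
  have h5 := mul_le_mul_of_nonneg_left (integral_phaseLift_sq_le hc)
    (mul_nonneg hC0 (by positivity : (0 : ℝ) ≤ 1 + 1 / θ))
  linarith

theorem integral_hessian_base_change (v : ℝ) (w : Plane → Plane) {xO xD : Plane}
    {ξ ξ' : ℝ → Plane} (hξ : ξ ∈ pathSpace xO xD) (hξ' : ξ' ∈ pathSpace xO xD) {C ω : ℝ}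
    (hω : 0 ≤ ω)
    (hC : ∀ᵐ τ ∂unitMeasure, ‖integrandHessian v w (phaseLift ξ τ)‖ ≤ C)
    (hC' : ∀ᵐ τ ∂unitMeasure, ‖integrandHessian v w (phaseLift ξ' τ)‖ ≤ C)
    (hd : ∀ᵐ τ ∂unitMeasure, ‖integrandHessian v w (phaseLift ξ τ)
      - integrandHessian v w (phaseLift ξ' τ)‖ ≤ ω)
    {x : State} (hx : x ∈ dirZ) :
    (∫ τ, integrandHessian v w (phaseLift ξ' τ) (phaseLift x.2 τ) (phaseLift x.2 τ) ∂unitMeasure)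
      - ω * normZTwo x ^ 2 ≤
    ∫ τ, integrandHessian v w (phaseLift ξ τ) (phaseLift x.2 τ) (phaseLift x.2 τ)
      ∂unitMeasure := by
  have i1 := integrable_integrandHessian v w hξ hC hx
  have i1' := integrable_integrandHessian v w hξ' hC' hx
  have i2 := (integrable_phaseLift_sq hx).const_mul ω
  have h := integral_mono_ae (i1'.sub i2) i1 (by
    filter_upwards [hd] with τ h
    have h1 := (integrandHessian v w (phaseLift ξ τ)
      - integrandHessian v w (phaseLift ξ' τ)).le_opNorm₂ (phaseLift x.2 τ) (phaseLift x.2 τ)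
    have h2 : ‖integrandHessian v w (phaseLift ξ τ) - integrandHessian v w (phaseLift ξ' τ)‖
        * ‖phaseLift x.2 τ‖ * ‖phaseLift x.2 τ‖ ≤ ω * ‖phaseLift x.2 τ‖ ^ 2 := by
      rw [mul_assoc, ← sq]; gcongr
    have h3 := (abs_le.1 (h1.trans h2)).1
    simp only [sub_apply] at h3
    simp only [Pi.sub_apply]
    linarith)
  have e1 := integral_sub' i1' i2
  rw [e1, integral_const_mul] at h
  have h4 := mul_le_mul_of_nonneg_left (integral_phaseLift_sq_le hx) hω
  linarith

/-! ### The neighbourhood of the solution -/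

/-- The bound for the representing function is `2 R` rather than `R`, as `multiplierNormInf` is an
infimum. -/
theorem nhdY_bounds {xO xD : Plane} {χ χ' : PrimalDual} (hχ : χ.1 ∈ stateSpace xO xD) {R : ℝ}
    (hR : 0 < R) (h : χ' ∈ nhdY xO xD χ R) :
    |χ'.1.1 - χ.1.1| ≤ R ∧
      (∀ᵐ τ ∂unitMeasure, ‖χ'.1.2 τ - χ.1.2 τ‖ ≤ R) ∧
      (∀ᵐ τ ∂unitMeasure, ‖deriv χ'.1.2 τ - deriv χ.1.2 τ‖ ≤ R) ∧
      ∃ m, Represents m (χ'.2 - χ.2) ∧ ∀ᵐ τ ∂unitMeasure, ‖m τ‖ ≤ 2 * R := by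
  obtain ⟨hχ', hn⟩ := h
  rw [normYInf, normZInf] at hn
  have h1 : ‖(χ' - χ).1.1‖ₑ ≤ ENNReal.ofReal R :=
    le_self_add.trans (le_self_add.trans (le_self_add.trans hn))
  have h2 : eLpNorm (χ' - χ).1.2 ∞ unitMeasure ≤ ENNReal.ofReal R :=
    le_add_self.trans (le_self_add.trans (le_self_add.trans hn))
  have h3 : eLpNorm (deriv (χ' - χ).1.2) ∞ unitMeasure ≤ ENNReal.ofReal R :=
    le_add_self.trans (le_self_add.trans hn)
  have h4 : multiplierNormInf (χ' - χ).2 ≤ ENNReal.ofReal R := le_add_self.trans hn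
  refine ⟨?_, ae_norm_le_of_eLpNorm_top_le hR.le h2, ?_, ?_⟩
  · rw [← ofReal_norm] at h1
    exact (ENNReal.ofReal_le_ofReal_iff hR.le).1 h1
  · filter_upwards [ae_norm_le_of_eLpNorm_top_le hR.le h3, ae_deriv_sub hχ' hχ] with τ h5 h6
    rw [← h6]
    exact h5
  · have h5 : multiplierNormInf (χ' - χ).2 < ENNReal.ofReal (2 * R) :=
      h4.trans_lt ((ENNReal.ofReal_lt_ofReal_iff (by linarith)).2 (by linarith))
    rw [multiplierNormInf, iInf_lt_iff] at h5
    obtain ⟨m, hm⟩ := h5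
    rw [iInf_lt_iff] at hm
    obtain ⟨hrep, hm⟩ := hm
    exact ⟨m, hrep, ae_norm_le_of_eLpNorm_top_le (by linarith) hm.le⟩

/-- The contribution of a small multiplier to the second derivative of the Lagrangian is small
relative to the `L²`-type norm, because the multiplier is bounded as a function. -/
theorem pairing_constraint_ge {l : Multiplier} {m : ℝ → ℝ} (hm : Represents m l) {D : ℝ}
    (hD0 : 0 ≤ D) (hD : ∀ᵐ τ ∂unitMeasure, ‖m τ‖ ≤ D) {x : State} (hx : x ∈ dirZ) :
    -(D * normZTwo x ^ 2) ≤ pairing l (constraint x) := by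
  have hmem : MemLp (constraint x) ∞ unitMeasure := memLp_constraint (xO := 0) (xD := 0) hx
  have i2 : Integrable (fun τ => ‖deriv x.2 τ‖ ^ 2) unitMeasure :=
    (memLp_two_deriv_path hx).integrable_norm_pow (by norm_num)
  rw [pairing_eq l hmem, hm.2]
  have h1 : ‖∫ τ, m τ * hmem.toLp _ τ ∂unitMeasure‖
      ≤ ∫ τ, D * (‖deriv x.2 τ‖ ^ 2 + x.1 ^ 2) ∂unitMeasure := by
    refine norm_integral_le_of_norm_le ((i2.add (integrable_const _)).const_mul D) ?_
    filter_upwards [hD, hmem.coeFn_toLp] with τ h h'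
    rw [h', norm_mul]
    refine mul_le_mul h ?_ (norm_nonneg _) hD0
    rw [constraint, Real.norm_eq_abs, abs_le]
    constructor <;> nlinarith [sq_nonneg ‖deriv x.2 τ‖, sq_nonneg x.1]
  rw [integral_const_mul, integral_add i2 (integrable_const _), integral_const] at h1
  simp only [probReal_univ, smul_eq_mul, one_mul] at h1
  have h2 := sq_add_integral_le_normZTwo_sq hx
  have h3 : (0 : ℝ) ≤ ∫ τ, ‖x.2 τ‖ ^ 2 ∂unitMeasure := integral_nonneg fun _ => by positivity
  have h4 := mul_le_mul_of_nonneg_left (show ∫ τ, ‖deriv x.2 τ‖ ^ 2 ∂unitMeasure + x.1 ^ 2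
    ≤ normZTwo x ^ 2 by linarith) hD0
  have h5 := (abs_le.1 h1).1
  linarith

/-- A direction in the kernel of the linearized constraint at a nearby state is close to a
direction in the kernel at the given state. -/
theorem exists_kernel_correction {xO xD : Plane} {z z' : State} (hz : z ∈ stateSpace xO xD)
    {C : ℝ} (hC0 : 0 ≤ C)
    (hC : ∀ g : ℝ → ℝ, MemLp g ∞ unitMeasure → ∃ c ∈ dirZ,
      (∀ᵐ τ ∂unitMeasure, inner ℝ (deriv z.2 τ) (deriv c.2 τ) - z.1 * c.1 = g τ) ∧
      normZTwo c ≤ C * normLTwo g) {R : ℝ} (hR : 0 ≤ R)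
    (h1 : |z'.1 - z.1| ≤ R) (h2 : ∀ᵐ τ ∂unitMeasure, ‖deriv z'.2 τ - deriv z.2 τ‖ ≤ R)
    {x : State} (hx : x ∈ dirZ) (hker : InConstraintKernel z' x) :
    ∃ c ∈ dirZ, InConstraintKernel z (x + c) ∧ normZTwo c ≤ C * (R * normZTwo x) := by
  have hmem : MemLp (fun τ => -(1 / 2 * constraintDeriv z x τ)) ∞ unitMeasure :=
    ((memLp_constraintDeriv hz hx).const_mul (1 / 2)).neg
  obtain ⟨c, hc, hcg, hcn⟩ := hC _ hmem
  refine ⟨c, hc, ?_, hcn.trans (mul_le_mul_of_nonneg_left ?_ hC0)⟩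
  · filter_upwards [hcg, dirZ_ae_deriv_add hx hc] with τ h3 h4
    rw [h4, inner_add_right, Prod.fst_add]
    rw [constraintDeriv] at h3
    linarith
  · have h5 := normLTwo_le_of_ae_le (f := fun τ => -(1 / 2 * constraintDeriv z x τ))
      (memLp_two_deriv_path hx) hR (D := R * |x.1|) (by positivity) (by
        filter_upwards [h2, hker] with τ h6 h7
        have e : -(1 / 2 * constraintDeriv z x τ)
            = inner ℝ (deriv z'.2 τ - deriv z.2 τ) (deriv x.2 τ) - (z'.1 - z.1) * x.1 := by
          rw [inner_sub_left, h7, constraintDeriv]; ring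
        rw [e]
        refine (norm_sub_le _ _).trans (add_le_add ?_ ?_)
        · exact (norm_inner_le_norm _ _).trans (by gcongr)
        · rw [norm_mul, Real.norm_eq_abs, Real.norm_eq_abs]; gcongr)
    refine h5.trans ?_
    rw [normZTwo_eq, ← mul_add]
    exact mul_le_mul_of_nonneg_left (by linarith [normLTwo_nonneg x.2]) hR

/-! ### Persistence of the second order sufficient condition -/

/-- With vanishing multiplier, all sufficiently small radii are admissible for the second order
estimate. -/
theorem eventually_second_order_growth {v : ℝ} {w : Plane → Plane} (hw : ContDiff ℝ 3 w)
    (hwv : ∀ p, ‖w p‖ < v) {xO xD : Plane} (hne : xO ≠ xD) {χ : PrimalDual}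
    (hz : χ.1 ∈ stateSpace xO xD)
    (hc : ∀ᵐ τ ∂unitMeasure, ‖deriv χ.1.2 τ‖ ^ 2 = χ.1.1 ^ 2) (hmul : χ.2 = 0)
    {B : ℝ} (hB : 0 < B) (hsuff : SufficientCondition v w χ.1 B) :
    ∀ᶠ R in 𝓝[>] (0 : ℝ), ∀ χ' ∈ nhdY xO xD χ R, ∀ dz ∈ dirZ, InConstraintKernel χ'.1 dz →
      TwiceDifferentiableAt (lagrangianLine v w χ' dz) 0 ∧
      B / 4 * normZTwo dz ^ 2 ≤ lagrangianZZ v w χ' dz := by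
  have hL := length_ne_zero hne hz hc
  obtain ⟨l, hl⟩ : ∃ l, l = |χ.1.1| := ⟨_, rfl⟩
  have hl0 : 0 < l := by rw [hl]; exact abs_pos.2 hL
  obtain ⟨M, -, hM⟩ := pathSpace_norm_le hz
  obtain ⟨C, hC0, hC⟩ := exists_linearized_constraint_eq hne hz hc hL
  obtain ⟨H, hH⟩ := (isCompact_speedAnnulus (M + 1) l).exists_bound_of_continuousOn
    (f := integrandHessian v w)
    (continuousOn_integrandHessian hw hwv hl0)
  obtain ⟨D, hD⟩ : ∃ D, D = max H 1 := ⟨_, rfl⟩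
  have hD0 : 0 < D := by rw [hD]; exact lt_max_of_lt_right one_pos
  have hHD : ∀ x ∈ speedAnnulus (M + 1) l, ‖integrandHessian v w x‖ ≤ D := fun x hx =>
    (hH x hx).trans (by rw [hD]; exact le_max_left _ _)
  obtain ⟨ρ, hρ, huni⟩ := integrandHessian_uniform hw hwv (M + 1) hl0
    (show 0 < B / 16 by positivity)
  -- The weight that makes the first error term `B / 8` times the main term.
  obtain ⟨θ, hθ⟩ : ∃ θ, θ = B / (8 * D) := ⟨_, rfl⟩
  have hθ0 : 0 < θ := by rw [hθ]; positivity
  have hDθ : D * θ = B / 8 := by rw [hθ]; field_simp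
  have small : ∀ (f : ℝ → ℝ) (b : ℝ), Continuous f → f 0 < b → ∀ᶠ R in 𝓝[>] (0 : ℝ), f R < b :=
    fun f b hf h0 => (hf.tendsto 0).mono_left nhdsWithin_le_nhds |>.eventually_lt_const h0
  filter_upwards [self_mem_nhdsWithin,
    small (fun R => R) (min (min 1 ρ) (min (l / 4) (B / 64))) continuous_id (by positivity),
    small (fun R => C * R) (1 / 8) (by fun_prop) (by norm_num),
    small (fun R => D * (1 + 1 / θ) * (C * R) ^ 2) (B / 16) (by fun_prop) (by
      simp only [mul_zero, zero_pow two_ne_zero]; positivity)]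
    with R hR hsmall hCR hDR χ' hχ' dz hdz hker
  have hR0 : (0 : ℝ) < R := hR
  simp only [lt_min_iff] at hsmall
  obtain ⟨⟨hR1, hRρ⟩, hRl, hRB⟩ := hsmall
  obtain ⟨b1, b2, b3, m, hm, hmb⟩ := nhdY_bounds hz hR0 hχ'
  have hz' : χ'.1 ∈ stateSpace xO xD := hχ'.1
  have hbase : ∀ᵐ τ ∂unitMeasure, ‖χ.1.2 τ‖ ≤ M + 1 ∧ 3 / 4 * l ≤ ‖deriv χ.1.2 τ‖ ∧
      ‖deriv χ.1.2 τ‖ ≤ 5 / 4 * l := by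
    filter_upwards [hc, ae_unitMeasure_mem] with τ h hτ
    rw [norm_deriv_eq_of_sq_eq h, ← hl]
    exact ⟨by linarith [hM τ hτ], by linarith, by linarith⟩
  have hnear : ∀ᵐ τ ∂unitMeasure, ‖χ'.1.2 τ‖ ≤ M + 1 ∧ 3 / 4 * l ≤ ‖deriv χ'.1.2 τ‖ ∧
      ‖deriv χ'.1.2 τ‖ ≤ 5 / 4 * l := by
    filter_upwards [hc, ae_unitMeasure_mem, b2, b3] with τ h hτ h2 h3
    have e1 : ‖deriv χ.1.2 τ‖ = l := by rw [norm_deriv_eq_of_sq_eq h, hl]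
    have e2 := abs_le.1 (abs_norm_sub_norm_le (χ'.1.2 τ) (χ.1.2 τ))
    have e3 := abs_le.1 (abs_norm_sub_norm_le (deriv χ'.1.2 τ) (deriv χ.1.2 τ))
    exact ⟨by linarith [hM τ hτ, e2.2], by linarith [e3.1], by linarith [e3.2]⟩
  have hann : ∀ {ξ : ℝ → Plane}, (∀ᵐ τ ∂unitMeasure, ‖ξ τ‖ ≤ M + 1 ∧ 3 / 4 * l ≤ ‖deriv ξ τ‖ ∧
      ‖deriv ξ τ‖ ≤ 5 / 4 * l) → ∀ᵐ τ ∂unitMeasure, phaseLift ξ τ ∈ speedAnnulus (M + 1) l := by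
    intro ξ h
    filter_upwards [h] with τ h
    exact ⟨h.1, by show l / 2 ≤ ‖deriv ξ τ‖; linarith [h.2.1],
      by show ‖deriv ξ τ‖ ≤ 2 * l; linarith [h.2.2]⟩
  have hHbase := (hann hbase).mono fun τ h => hHD _ h
  have hHnear := (hann hnear).mono fun τ h => hHD _ h
  have hHdiff : ∀ᵐ τ ∂unitMeasure, ‖integrandHessian v w (phaseLift χ'.1.2 τ)
      - integrandHessian v w (phaseLift χ.1.2 τ)‖ ≤ B / 16 := by
    filter_upwards [hann hbase, hann hnear, b2, b3] with τ h1 h2 h3 h4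
    refine huni _ h2 _ h1 (lt_of_le_of_lt ?_ hRρ)
    rw [dist_eq_norm, phaseLift, phaseLift, Prod.mk_sub_mk, Prod.norm_mk]
    exact max_le h3 h4
  obtain ⟨hT, hT2⟩ := travelTime_line hw hwv hl0 hz' hdz hnear
  obtain ⟨hlag1, -, hlag2⟩ := lagrangian_line hz' hdz hT
  refine ⟨hlag1, ?_⟩
  obtain ⟨c, hcZ, hcker, hcn⟩ := exists_kernel_correction hz hC0 hC hR0.le b1 b3 hdz hker
  have hy := dirZ_add hdz hcZ
  have g1 := hsuff _ hy hcker
  rw [travelTimeSecond, (travelTime_line hw hwv hl0 hz hy hbase).2] at g1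
  have g2 := integral_hessian_perturbation v w hz hD0.le hHbase hθ0 hdz hcZ
  have g3 := integral_hessian_base_change v w hz' hz (show (0 : ℝ) ≤ B / 16 by positivity) hHnear
    hHbase hHdiff hdz
  rw [hmul, sub_zero] at hm
  have g4 := pairing_constraint_ge hm (by positivity) hmb hdz
  rw [hlag2, travelTimeSecond, hT2]
  -- The losses add up to `(7/8) (49/64) - 1/16 - 1/16 - 1/16 ≥ 1/4` of `B ‖δz‖²`.
  have hN0 := normZTwo_nonneg dz
  have hNc0 := normZTwo_nonneg c
  have g5 := le_normZTwo_of_add hdz hcZ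
  have g6 : normZTwo c ≤ 1 / 8 * normZTwo dz := by nlinarith
  have g7 : (49 / 64) * normZTwo dz ^ 2 ≤ normZTwo (dz + c) ^ 2 := by
    have : 7 / 8 * normZTwo dz ≤ normZTwo (dz + c) := by linarith
    nlinarith
  have g8 : D * (1 + 1 / θ) * normZTwo c ^ 2 ≤ B / 16 * normZTwo dz ^ 2 := by
    have h1 : normZTwo c ^ 2 ≤ (C * R) ^ 2 * normZTwo dz ^ 2 := by
      rw [← mul_pow]
      exact pow_le_pow_left₀ hNc0 (by linarith) 2
    calc D * (1 + 1 / θ) * normZTwo c ^ 2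
        ≤ D * (1 + 1 / θ) * ((C * R) ^ 2 * normZTwo dz ^ 2) := by gcongr
      _ = D * (1 + 1 / θ) * (C * R) ^ 2 * normZTwo dz ^ 2 := by ring
      _ ≤ B / 16 * normZTwo dz ^ 2 := by gcongr
  have g9 : 2 * R * normZTwo dz ^ 2 ≤ B / 32 * normZTwo dz ^ 2 := by
    have : 2 * R ≤ B / 32 := by linarith
    gcongr
  rw [hDθ] at g2
  have g10 := mul_le_mul_of_nonneg_left g7 (show 0 ≤ 7 / 8 * B by positivity)
  have g11 : 0 ≤ B * normZTwo dz ^ 2 := by positivity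
  linarith

/-- The condition on the radius holds for all small radii, as `Γ̄` is continuous and positive at
`R = 0`. -/
theorem eventually_radius_lt {v c0 c1 c2 c3 Lt B : ℝ} (hLt : 0 < Lt) (hB : 0 < B)
    (hΓ : 0 < Gamma v c0 c1 c2 c3 Lt 0) :
    ∀ᶠ R in 𝓝[>] (0 : ℝ),
      R < min (min (B / (2 * Gamma v c0 c1 c2 c3 Lt R)) (B / 40)) (Lt / 2) := by
  have hLt' : Lt - 0 ≠ 0 := by rw [sub_zero]; exact hLt.ne'
  have hcont : ContinuousAt (fun R => Gamma v c0 c1 c2 c3 Lt R) 0 := by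
    unfold Gamma
    have h1 : 2 * (Lt - 0) ≠ 0 := mul_ne_zero two_ne_zero hLt'
    have h2 : (Lt - 0) ^ 2 ≠ 0 := pow_ne_zero 2 hLt'
    refine ContinuousAt.sup (ContinuousAt.sup ?_ ?_) (ContinuousAt.sup ?_ ?_) <;>
      fun_prop (disch := assumption)
  have hcont' : ContinuousAt
      (fun R => min (min (B / (2 * Gamma v c0 c1 c2 c3 Lt R)) (B / 40)) (Lt / 2)) 0 :=
    ((continuousAt_const.div (hcont.const_mul 2) (by positivity)).inf continuousAt_const).inf
      continuousAt_const
  refine Filter.Eventually.filter_mono nhdsWithin_le_nhds ?_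
  exact continuousAt_id.eventually_lt hcont' (by simp only [id]; positivity)

theorem Gamma_zero_pos {v c0 c1 c2 c3 Lt : ℝ} (hv : 0 < vLow v c0) (hc1 : 0 ≤ c1)
    (hLt : 0 < Lt) : 0 < Gamma v c0 c1 c2 c3 Lt 0 := by
  refine lt_of_lt_of_le ?_ ((le_max_right _ _).trans (le_max_right _ _))
  rw [gamma3, gamma5, sub_zero]
  positivity

theorem vLow_pos {v c0 : ℝ} (hc0 : 0 ≤ c0) (h : c0 < v / √5) : 0 < vLow v c0 := by
  have h5 : (1 : ℝ) ≤ √5 := Real.one_le_sqrt.2 (by norm_num)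
  have h1 : c0 * √5 < v := (lt_div_iff₀ (by positivity)).1 h
  have h2 : c0 < v := by nlinarith
  exact Real.sqrt_pos.2 (by nlinarith)

end FreeFlight

theorem mainTheorem3
    (v : ℝ) (w : FreeFlight.Plane → FreeFlight.Plane)
    (hw : ContDiff ℝ 3 w) (hwv : ∀ p, ‖w p‖ < v)
    (xO xD : FreeFlight.Plane)
    (a : ℝ) (ha : ‖xD - xO‖ < a)
    (c0 c1 c2 c3 : ℝ) (hc0v : c0 < v / √5)
    (hc0 : ∀ p ∈ FreeFlight.ellipse xO xD a, ‖w p‖ ≤ c0)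
    (hc1 : ∀ p ∈ FreeFlight.ellipse xO xD a, ‖fderiv ℝ w p‖ ≤ c1)
    (hc2 : ∀ p ∈ FreeFlight.ellipse xO xD a, ‖iteratedFDeriv ℝ 2 w p‖ ≤ c2)
    (hc3 : ∀ p ∈ FreeFlight.ellipse xO xD a, ‖iteratedFDeriv ℝ 3 w p‖ ≤ c3)
    (χg : FreeFlight.PrimalDual)
    (hglob : FreeFlight.IsGlobalSolution v w xO xD χg.1)
    (hnec : FreeFlight.NecessaryConditions v w χg)
    (hinfsup : FreeFlight.InfSupCondition χg.1)
    (B : ℝ) (hB : 0 < B)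
    (hsuff : FreeFlight.SufficientCondition v w χg.1 B) :
    ∃ R : ℝ, 0 < R ∧
      R < min (min (B / (2 * FreeFlight.Gamma v c0 c1 c2 c3 ‖xD - xO‖ R)) (B / 40))
        (‖xD - xO‖ / 2) ∧
      ∀ χ ∈ FreeFlight.nhdY xO xD χg R, ∀ dz ∈ FreeFlight.dirZ,
        FreeFlight.InConstraintKernel χ.1 dz →
          FreeFlight.TwiceDifferentiableAt (FreeFlight.lagrangianLine v w χ dz) 0 ∧
          B / 4 * FreeFlight.normZTwo dz ^ 2 ≤ FreeFlight.lagrangianZZ v w χ dz := by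
  open FreeFlight in
  have hne := endpoints_ne_of_infSup hw.continuous hwv hglob hinfsup
  have hLt : 0 < ‖xD - xO‖ := norm_pos_iff.2 (sub_ne_zero.2 hne.symm)
  have hmul := multiplier_eq_zero hw hwv hne hglob hnec
  have hmem : xO ∈ ellipse xO xD a := by
    show dist xO xO + dist xO xD ≤ a
    rw [dist_self, zero_add, dist_eq_norm, norm_sub_rev]
    exact ha.le
  have hΓ := Gamma_zero_pos (c2 := c2) (c3 := c3)
    (vLow_pos ((norm_nonneg _).trans (hc0 xO hmem)) hc0v)
    ((norm_nonneg _).trans (hc1 xO hmem)) hLt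
  obtain ⟨R, hR0, hR, hgrow⟩ := (eventually_mem_nhdsWithin.and ((eventually_radius_lt hLt hB hΓ).and
    (eventually_second_order_growth hw hwv hne hglob.1 hglob.2.1 hmul hB hsuff))).exists
  exact ⟨R, hR0, hR, hgrow⟩
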